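/- Let $M,N\ge 1$ be integers, write points of $\mathbb R^{M+N}$ as $x=(\mathbf v,\mathbf w)$ with $\mathbf v\in\mathbb R^M$, $\mathbf w\in\mathbb R^N$, and let $\sigma$ be the normalized uniform measure on the sphere $\mathbb S=\mathbb S^{M+N-1}(\sqrt{M+N})$ of radius $\sqrt{M+N}$ in $\mathbb R^{M+N}$. Let $\nu$ be a probability measure on angles (on the circle, or on $\mathbb R$) with $\int \nu(d\theta)\sin\theta\cos\theta=0$. For $i\neq j$ let $r_{ij}(\theta)$ be the rotation for which $r_{ij}(\theta)^{-1}x$ has $i$-th coordinate $x_i\cos\theta-x_j\sin\theta$, $j$-th coordinate $x_i\sin\theta+x_j\cos\theta$ and the same other coordinates as $x$, and let $(R_{ij}F)(x)=\int\nu(d\theta)\,F(r_{ij}(\theta)^{-1}x)$ on $L^1(\mathbb S,\sigma)$. For rates $\lambda_S,\lambda_R,\mu\ge 0$ let $$\mathcal L=\frac{\lambda_S}{M-1}\sum_{1\le i<j\le M}(R_{ij}-I)+\frac{\lambda_R}{N-1}\sum_{M<i<j\le M+N}(R_{ij}-I)+\frac{\mu}{N}\sum_{i=1}^{M}\sum_{j=M+1}^{M+N}(R_{ij}-I),$$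 a bounded operator on $L^1(\mathbb S,\sigma)$ (the first sum is absent if $M=1$, the second if $N=1$), and let $e^{\mathcal L t}$ be the semigroup that it generates. Let $\mathcal N F(\mathbf v,\mathbf w)=\int_{SO(N)}F(\mathbf v,S^{-1}\mathbf w)\,dS$, with the normalized Haar measure $dS$ on $SO(N)$. For $0\le F\in L^1(\mathbb S,\sigma)$ let $$I(F)=\int_{\mathbb S}\frac{|\nabla F|^2}{F}\,d\sigma\in[0,\infty],$$ where $\nabla F$ is the weak gradient on $\mathbb S$, $|\cdot|$ is the length in the metric of $\mathbb S$, the integrand is $0$ where $\nabla F=0$, and $I(F)=\infty$ if $F$ has no integrable weak gradient. Put $\mu_\nu=\mu\int\nu(d\theta)\sin^2\theta$. Let $F_0\in L^1(\mathbb S,\sigma)$ be nonnegative (for instance a probability density) and invariant under all rotations that fix $\mathbf v$, that is, $F_0(\mathbf v,S\mathbf w)=F_0(\mathbf v,\mathbf w)$ for all $S\in SO(N)$. Then for all $t\ge 0$ $$I(\mathcal N e^{\mathcal L t}F_0)\le\left[2\left(\frac{M}{M+N}+e^{-\mu_\nu\frac{M+N}{N}t}\,\frac{N}{M+N}\right)+\frac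 MN\right]I(F_0).$$ -/

import Mathlib

open MeasureTheory Matrix
open scoped ENNReal ContDiff

namespace Kac

noncomputable section

/-! ### The special orthogonal group and its Haar measure -/

instance instIsTopologicalGroupSO (n : Type*) [Fintype n] [DecidableEq n] :
    IsTopologicalGroup (specialOrthogonalGroup n ℝ) where
  continuous_inv := by
    refine Continuous.subtype_mk ?_ _
    exact continuous_star.comp continuous_subtype_val

instance instCompactSpaceSO (n : Type*) [Fintype n] [DecidableEq n] :
    CompactSpace (specialOrthogonalGroup n ℝ) := by
  have hclosed : IsClosed {A : Matrix n n ℝ | A * star A = 1 ∧ A.det = 1} :=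
    (isClosed_eq (continuous_id.mul continuous_star) continuous_const).inter
      (isClosed_eq (Continuous.matrix_det continuous_id) continuous_const)
  have hset : (specialOrthogonalGroup n ℝ : Set (Matrix n n ℝ)) =
      {A : Matrix n n ℝ | A * star A = 1 ∧ A.det = 1} := by
    ext A
    exact mem_specialOrthogonalGroup_iff.trans (and_congr_left' mem_unitaryGroup_iff)
  have hcpt : IsCompact (Set.pi Set.univ (fun _ : n => Set.pi Set.univ
      (fun _ : n => Set.Icc (-1 : ℝ) 1))) :=
    isCompact_univ_pi fun _ => isCompact_univ_pi fun _ => isCompact_Icc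
  have : IsCompact (specialOrthogonalGroup n ℝ : Set (Matrix n n ℝ)) := by
    refine hcpt.of_isClosed_subset (hset ▸ hclosed) ?_
    intro A hA i _ j _
    have h := entry_norm_bound_of_unitary (mem_specialOrthogonalGroup_iff.1 hA).1 i j
    exact abs_le.1 h
  exact isCompact_iff_compactSpace.1 this

instance instMeasurableSpaceSO (n : Type*) [Fintype n] [DecidableEq n] :
    MeasurableSpace (specialOrthogonalGroup n ℝ) := borel _

instance instBorelSpaceSO (n : Type*) [Fintype n] [DecidableEq n] :
    BorelSpace (specialOrthogonalGroup n ℝ) := ⟨rfl⟩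

/-- The normalized Haar measure on `SO(n)`. -/
def haarSO (n : Type*) [Fintype n] [DecidableEq n] : Measure (specialOrthogonalGroup n ℝ) :=
  Measure.haarMeasure ⊤

/-! ### The sphere, its uniform probability measure, and rotations -/

/-- The normalized uniform measure on the sphere of radius `r` about the origin of `ℝ^ι`,
as a measure on the ambient space: functions on the sphere are represented by functions on
`ℝ^ι`, whose values off the sphere play no role. -/
def sphereMeasure (ι : Type*) [Fintype ι] (r : ℝ) : Measure (EuclideanSpace ℝ ι) :=
  ((volume : Measure (EuclideanSpace ℝ ι)).toSphere Set.univ)⁻¹ •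
    (volume : Measure (EuclideanSpace ℝ ι)).toSphere.map
      (fun x : Metric.sphere (0 : EuclideanSpace ℝ ι) 1 => r • (x : EuclideanSpace ℝ ι))

theorem measurable_smul_coe {ι : Type*} [Fintype ι] (r : ℝ) :
    Measurable (fun x : Metric.sphere (0 : EuclideanSpace ℝ ι) 1 =>
      r • (x : EuclideanSpace ℝ ι)) := by
  fun_prop

instance instIsFiniteMeasureSphere {ι : Type*} [Fintype ι] (r : ℝ) :
    IsFiniteMeasure (sphereMeasure ι r) := by
  constructor
  rw [sphereMeasure, Measure.smul_apply, Measure.map_apply (measurable_smul_coe r) .univ,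
    Set.preimage_univ, smul_eq_mul]
  exact (ENNReal.inv_mul_le_one _).trans_lt ENNReal.one_lt_top

instance instIsProbabilityMeasureSphere {ι : Type*} [Fintype ι] [Nonempty ι] (r : ℝ) :
    IsProbabilityMeasure (sphereMeasure ι r) := by
  constructor
  rw [sphereMeasure, Measure.smul_apply, Measure.map_apply (measurable_smul_coe r) .univ,
    Set.preimage_univ, smul_eq_mul]
  refine ENNReal.inv_mul_cancel ?_ (measure_ne_top _ _)
  exact fun h => Measure.toSphere_ne_zero _ (Measure.measure_univ_eq_zero.1 h)

/-- The action of an orthogonal matrix on Euclidean space. -/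
def rot {ι : Type*} [Fintype ι] [DecidableEq ι] (g : orthogonalGroup ι ℝ) :
    EuclideanSpace ℝ ι ≃ₗᵢ[ℝ] EuclideanSpace ℝ ι :=
  Unitary.linearIsometryEquiv
    ⟨toEuclideanCLM (𝕜 := ℝ) (n := ι) (g : Matrix ι ι ℝ), Unitary.map_mem _ g.2⟩

theorem rot_apply {ι : Type*} [Fintype ι] [DecidableEq ι] (g : orthogonalGroup ι ℝ)
    (x : EuclideanSpace ℝ ι) (k : ι) : rot g x k = ((g : Matrix ι ι ℝ) *ᵥ x.ofLp) k :=
  rfl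

open scoped Pointwise in
theorem toSphere_preimage_isometry {E : Type*} [NormedAddCommGroup E] [InnerProductSpace ℝ E]
    [FiniteDimensional ℝ E] [MeasurableSpace E] [BorelSpace E] (r : ℝ) (e : E ≃ₗᵢ[ℝ] E)
    {s : Set E} (hs : MeasurableSet s) :
    (volume : Measure E).toSphere ((fun x : Metric.sphere (0 : E) 1 => r • (x : E)) ⁻¹' (e ⁻¹' s))
      = (volume : Measure E).toSphere ((fun x : Metric.sphere (0 : E) 1 => r • (x : E)) ⁻¹' s) := by
  have hf : Measurable (fun x : Metric.sphere (0 : E) 1 => r • (x : E)) := by fun_prop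
  rw [Measure.toSphere_apply' _ (hf hs),
    Measure.toSphere_apply' _ (hf (e.continuous.measurable hs))]
  congr 1
  rw [← e.measurePreserving.measure_preimage_emb e.toHomeomorph.measurableEmbedding
    (Set.Ioo (0 : ℝ) 1 • (Subtype.val '' ((fun x : Metric.sphere (0 : E) 1 => r • (x : E)) ⁻¹' s)))]
  congr 1
  ext x
  simp only [Set.mem_smul, Set.mem_preimage, Set.mem_image, Subtype.exists]
  constructor
  · rintro ⟨c, hc, _, ⟨y, hy, hys, rfl⟩, rfl⟩
    exact ⟨c, hc, e y, ⟨e y, by simpa using hy, by simpa using hys, rfl⟩, by simp⟩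
  · rintro ⟨c, hc, _, ⟨y, hy, hys, rfl⟩, hx⟩
    refine ⟨c, hc, e.symm y, ⟨e.symm y, by simpa using hy, by simpa using hys, rfl⟩, ?_⟩
    rw [← map_smul, hx, e.symm_apply_apply]

theorem measurePreserving_isometry {ι : Type*} [Fintype ι] (r : ℝ)
    (e : EuclideanSpace ℝ ι ≃ₗᵢ[ℝ] EuclideanSpace ℝ ι) :
    MeasurePreserving e (sphereMeasure ι r) (sphereMeasure ι r) := by
  have he : Measurable e := e.continuous.measurable
  refine ⟨he, ?_⟩
  ext s hs
  rw [Measure.map_apply he hs, sphereMeasure, Measure.smul_apply, Measure.smul_apply,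
    Measure.map_apply (measurable_smul_coe r) hs,
    Measure.map_apply (measurable_smul_coe r) (he hs), toSphere_preimage_isometry r e hs]

/-- `L¹` of the sphere of radius `r`, with respect to the normalized uniform measure. -/
abbrev SphereL1 (ι : Type*) [Fintype ι] (r : ℝ) : Type _ := Lp ℝ 1 (sphereMeasure ι r)

/-- The action of orthogonal matrices on functions: `(act g F)(x) = F (g⁻¹ x)`. -/
def act {ι : Type*} [Fintype ι] [DecidableEq ι] {r : ℝ} (g : orthogonalGroup ι ℝ) :
    SphereL1 ι r →ₗᵢ[ℝ] SphereL1 ι r :=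
  Lp.compMeasurePreservingₗᵢ ℝ (rot g⁻¹) (measurePreserving_isometry r (rot g⁻¹))

theorem act_coeFn {ι : Type*} [Fintype ι] [DecidableEq ι] {r : ℝ} (g : orthogonalGroup ι ℝ)
    (F : SphereL1 ι r) :
    ⇑(act g F) =ᵐ[sphereMeasure ι r] fun x => F (rot g⁻¹ x) :=
  Lp.coeFn_compMeasurePreserving F (measurePreserving_isometry r (rot g⁻¹))

theorem continuous_act {ι : Type*} [Fintype ι] [DecidableEq ι] {r : ℝ} (F : SphereL1 ι r) :
    Continuous fun g : orthogonalGroup ι ℝ => act g F := by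
  let c : orthogonalGroup ι ℝ → C(EuclideanSpace ℝ ι, EuclideanSpace ℝ ι) :=
    fun g => ⟨rot g⁻¹, (rot g⁻¹).continuous⟩
  have hc : Continuous c := by
    refine ContinuousMap.continuous_of_continuous_uncurry _ ?_
    change Continuous fun p : orthogonalGroup ι ℝ × EuclideanSpace ℝ ι =>
      WithLp.toLp 2 (((p.1⁻¹ : orthogonalGroup ι ℝ) : Matrix ι ι ℝ) *ᵥ p.2.ofLp)
    refine (PiLp.continuous_toLp 2 _).comp (Continuous.matrix_mulVec ?_ ?_)
    · exact continuous_subtype_val.comp (continuous_inv.comp continuous_fst)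
    · exact (PiLp.continuous_ofLp 2 _).comp continuous_snd
  exact (continuous_const (y := F)).compMeasurePreservingLp hc
    (fun g => measurePreserving_isometry r (rot g⁻¹)) ENNReal.one_ne_top

/-! ### Collisions and the Kac evolution -/

/-- The matrix of the rotation `r_{ij}(θ)` in the plane of the coordinates `i ≠ j`. -/
def planeMatrix {ι : Type*} [DecidableEq ι] (i j : ι) (θ : ℝ) : Matrix ι ι ℝ := fun a =>
  if a = i then Pi.single i (Real.cos θ) + Pi.single j (Real.sin θ)
  else if a = j then Pi.single i (-Real.sin θ) + Pi.single j (Real.cos θ)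
  else Pi.single a 1

theorem planeMatrix_mem {ι : Type*} [Fintype ι] [DecidableEq ι] {i j : ι} (h : i ≠ j) (θ : ℝ) :
    planeMatrix i j θ ∈ orthogonalGroup ι ℝ := by
  rw [mem_orthogonalGroup_iff]
  ext a b
  change planeMatrix i j θ a ⬝ᵥ planeMatrix i j θ b = _
  by_cases hai : a = i <;> by_cases haj : a = j <;> by_cases hbi : b = i <;>
    by_cases hbj : b = j <;>
    simp_all [planeMatrix, Pi.single_apply, Matrix.one_apply] <;> grind [Real.cos_sq_add_sin_sq θ]

/-- The rotation `r_{ij}(θ)`, characterized by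
`(r_{ij}(θ)⁻¹ x)_i = x_i cos θ - x_j sin θ`, `(r_{ij}(θ)⁻¹ x)_j = x_i sin θ + x_j cos θ`, the
other coordinates being unchanged. (For `i = j`, which never occurs, it is the identity.) -/
def planeRotation {ι : Type*} [Fintype ι] [DecidableEq ι] (i j : ι) (θ : ℝ) :
    orthogonalGroup ι ℝ :=
  if h : i ≠ j then ⟨planeMatrix i j θ, planeMatrix_mem h θ⟩ else 1

theorem rot_planeRotation_inv {ι : Type*} [Fintype ι] [DecidableEq ι] {i j : ι} (h : i ≠ j)
    (θ : ℝ) (x : EuclideanSpace ℝ ι) (k : ι) :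
    rot (planeRotation i j θ)⁻¹ x k =
      if k = i then x i * Real.cos θ - x j * Real.sin θ
      else if k = j then x i * Real.sin θ + x j * Real.cos θ
      else x k := by
  have ht : ((planeRotation i j θ)⁻¹ : orthogonalGroup ι ℝ).1 = planeMatrix i j (-θ) := by
    rw [planeRotation, dif_pos h]
    change (planeMatrix i j θ)ᵀ = _
    ext a b
    by_cases hai : a = i <;> by_cases haj : a = j <;> by_cases hbi : b = i <;>
      by_cases hbj : b = j <;>
      simp_all [planeMatrix, Pi.single_apply, eq_comm]
  rw [rot_apply, ht]
  change planeMatrix i j (-θ) k ⬝ᵥ x.ofLp = _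
  by_cases hki : k = i <;> by_cases hkj : k = j <;>
    simp_all [planeMatrix, add_dotProduct] <;> ring

theorem continuous_planeRotation {ι : Type*} [Fintype ι] [DecidableEq ι] (i j : ι) :
    Continuous (planeRotation i j : ℝ → orthogonalGroup ι ℝ) := by
  unfold planeRotation
  by_cases h : i ≠ j
  · simp only [dif_pos h]
    refine Continuous.subtype_mk (continuous_matrix fun a b => ?_) _
    unfold planeMatrix
    split_ifs <;> simp only [Pi.add_apply, Pi.single_apply] <;> split_ifs <;> fun_prop
  · simp only [dif_neg h]
    exact continuous_const

theorem integrable_act_planeRotation {ι : Type*} [Fintype ι] [DecidableEq ι] {r : ℝ}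
    (ν : Measure ℝ) [IsFiniteMeasure ν] (i j : ι) (F : SphereL1 ι r) :
    Integrable (fun θ : ℝ => act (planeRotation i j θ) F) ν := by
  refine Integrable.of_bound
    ((continuous_act F).comp (continuous_planeRotation i j)).aestronglyMeasurable ‖F‖ (.of_forall fun θ => ?_)
  rw [LinearIsometry.norm_map]

/-- The averaged collision operator `R_{ij} F = ∫ F ∘ r_{ij}(θ)⁻¹ ν(dθ)` on `L¹`. -/
def collision {ι : Type*} [Fintype ι] [DecidableEq ι] {r : ℝ} (ν : Measure ℝ)
    [IsProbabilityMeasure ν] (i j : ι) : SphereL1 ι r →L[ℝ] SphereL1 ι r :=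
  LinearMap.mkContinuous
    { toFun := fun F => ∫ θ, act (planeRotation i j θ) F ∂ν
      map_add' := fun F G => by
        simp only [map_add]
        exact integral_add (integrable_act_planeRotation ν i j F)
          (integrable_act_planeRotation ν i j G)
      map_smul' := fun c F => by
        simp only [map_smul, RingHom.id_apply]
        exact integral_smul c _ }
    1 fun F => by
      refine (norm_integral_le_of_norm_le_const (C := ‖F‖) (.of_forall fun θ => ?_)).trans ?_
      · rw [LinearIsometry.norm_map]
      · simp

/-- The labels of the particles: `inl i` for those of the system (with velocities `v`), `inr j`
for those of the reservoir (with velocities `w`). -/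
abbrev Particles (M N : ℕ) : Type := Fin M ⊕ Fin N

/-- States: `L¹` functions on the sphere of radius `√(M+N)` in `ℝ^{M+N}`. -/
abbrev State (M N : ℕ) : Type := SphereL1 (Particles M N) (Real.sqrt (M + N))

/-- The generator of the Kac evolution of a system of `M` particles coupled to a reservoir of
`N` particles, with rates `lamS`, `lamR`, `mu`. For `M = 1` (resp. `N = 1`) the first (resp. second)
sum is empty. -/
def generator (M N : ℕ) (lamS lamR mu : ℝ) (ν : Measure ℝ) [IsProbabilityMeasure ν] :
    State M N →L[ℝ] State M N :=
  (lamS / ((M : ℝ) - 1)) • ∑ i : Fin M, ∑ j ∈ Finset.Ioi i,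
      (collision ν (Sum.inl i) (Sum.inl j) - 1) +
    (lamR / ((N : ℝ) - 1)) • ∑ i : Fin N, ∑ j ∈ Finset.Ioi i,
      (collision ν (Sum.inr i) (Sum.inr j) - 1) +
    (mu / (N : ℝ)) • ∑ i : Fin M, ∑ j : Fin N,
      (collision ν (Sum.inl i) (Sum.inr j) - 1)

/-- The semigroup `e^{𝓛 t}`, for the bounded operator `𝓛` on `L¹`. -/
def evolution (M N : ℕ) (lamS lamR mu : ℝ) (ν : Measure ℝ) [IsProbabilityMeasure ν] (t : ℝ) :
    State M N →L[ℝ] State M N :=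
  NormedSpace.exp (t • generator M N lamS lamR mu ν)

/-! ### Rotations of the reservoir and the marginal -/

/-- The rotation `(v, w) ↦ (v, S w)` for `S ∈ SO(N)`. -/
def reservoirRotation {M N : ℕ} (S : specialOrthogonalGroup (Fin N) ℝ) :
    orthogonalGroup (Particles M N) ℝ :=
  ⟨fromBlocks 1 0 0 (S : Matrix (Fin N) (Fin N) ℝ), by
    have h := (mem_orthogonalGroup_iff _ _).1 (mem_specialOrthogonalGroup_iff.1 S.2).1
    rw [mem_orthogonalGroup_iff, fromBlocks_transpose, fromBlocks_multiply, h]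
    simp⟩

/-- The marginal `𝒩 F (v, w) = ∫_{SO(N)} F (v, S⁻¹ w) dS`. -/
def marginal {M N : ℕ} (F : State M N) : State M N :=
  ∫ S, act (reservoirRotation S) F ∂(haarSO (Fin N))

/-! ### Fisher information -/

/-- The vector field `x_i e_j - x_j e_i` generating the rotations in the `(i, j)` plane. These
fields are divergence-free on every sphere about the origin, and they span its tangent spaces. -/
def rotField {ι : Type*} [Fintype ι] [DecidableEq ι] (i j : ι) (x : EuclideanSpace ℝ ι) :
    EuclideanSpace ℝ ι :=
  x i • EuclideanSpace.single j 1 - x j • EuclideanSpace.single i 1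

/-- `G` is the weak (distributional) gradient of `F` on the sphere of radius `r`: an integrable
tangential vector field such that integration by parts
`∫ F (x_i ∂_j - x_j ∂_i) φ dσ = - ∫ φ (x_i G_j - x_j G_i) dσ` holds for all smooth `φ`. -/
structure IsWeakGradient {ι : Type*} [Fintype ι] [DecidableEq ι] (r : ℝ)
    (F : EuclideanSpace ℝ ι → ℝ) (G : EuclideanSpace ℝ ι → EuclideanSpace ℝ ι) : Prop where
  integrable : Integrable G (sphereMeasure ι r)
  tangent : ∀ᵐ x ∂(sphereMeasure ι r), inner ℝ x (G x) = 0
  integral_eq : ∀ (i j : ι) (φ : EuclideanSpace ℝ ι → ℝ), ContDiff ℝ ∞ φ →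
    ∫ x, F x * fderiv ℝ φ x (rotField i j x) ∂(sphereMeasure ι r) =
      -∫ x, φ x * inner ℝ (rotField i j x) (G x) ∂(sphereMeasure ι r)

/-- The Fisher information `I(F) = ∫ |∇F|² / F dσ` of a nonnegative `F` on the sphere of radius
`r`, with values in `[0, ∞]`. The weak gradient is unique up to null sets, so the infimum only
picks the value given by it, or `∞` if there is none. (In `[0, ∞]`, `0 / 0 = 0`, and
the weak gradient vanishes a.e. where `F` does.) -/
def fisherInformation {ι : Type*} [Fintype ι] [DecidableEq ι] (r : ℝ)
    (F : EuclideanSpace ℝ ι → ℝ) : ℝ≥0∞ :=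
  ⨅ (G : EuclideanSpace ℝ ι → EuclideanSpace ℝ ι) (_ : IsWeakGradient r F G),
    ∫⁻ x, ‖G x‖ₑ ^ 2 / ENNReal.ofReal (F x) ∂(sphereMeasure ι r)

/-- The Fisher information of a state on the sphere of radius `√(M+N)`. -/
def information {M N : ℕ} (F : State M N) : ℝ≥0∞ :=
  fisherInformation (Real.sqrt (M + N)) F

end

end Kac

/-!
The Fisher information is a supremum of continuous linear functionals: for `F ≥ 0` with weak
gradient `G`, `∫ |G|² / F dσ` is the supremum over bounded vector fields `h` of
`∫ (2 ⟪h, G⟫ - |h|² F) dσ`. Since `G` depends linearly on `F` and rotations act on pairs `(F, G)`,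
the evolution and the marginal can be carried out on pairs, and it suffices to bound these
functionals along the evolution.

The marginal is invariant under rotations of `w`, so its gradient in `w` is radial and only fields
`h` whose `w`-part is parallel to `w` matter. For such `h` a pointwise Cauchy-Schwarz inequality
bounds the functional at a rotated pair `g (F, G)` by the trace of the positive operator
`g (∫ (G ⊗ G + |G|² (x ⊗ x) / r²) / F dσ) g⁻¹` over the system coordinates only, and the marginal
preserves this bound. A collision averages such weighted diagonals: because
`∫ sin θ cos θ dν = 0`, it moves the fraction `∫ sin² θ dν` of the weights between its two
coordinates. Hence the evolution turns the weights `(1, 0)` on system and reservoir into the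
solution of a linear flow, in which the system weight is `M/(M+N) + e N/(M+N)`, with
`e = exp (-μ_ν ((M+N)/N) t)`, and the reservoir weight is smaller. As the full trace is `2 I(F)`,
this yields the factor `2 (M/(M+N) + e N/(M+N))`.
-/

namespace Kac

noncomputable section

/-! ### Rotations of the sphere -/

section Sphere

variable {ι : Type*} [Fintype ι] {r : ℝ}

theorem ae_norm_eq (r : ℝ) : ∀ᵐ x ∂(sphereMeasure ι r), ‖x‖ = |r| := by
  refine Measure.ae_smul_measure ?_ _
  rw [ae_map_iff (measurable_smul_coe r).aemeasurable
    (isClosed_eq continuous_norm continuous_const).measurableSet]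
  refine .of_forall fun x => ?_
  rw [norm_smul, mem_sphere_zero_iff_norm.1 x.2, mul_one, Real.norm_eq_abs]

theorem memLp_top_of_continuous {E : Type*} [NormedAddCommGroup E] {f : EuclideanSpace ℝ ι → E}
    (hf : Continuous f) : MemLp f ∞ (sphereMeasure ι r) := by
  obtain ⟨C, hC⟩ := (isCompact_closedBall (0 : EuclideanSpace ℝ ι) |r|).exists_bound_of_continuousOn
    hf.continuousOn
  exact memLp_top_of_bound hf.aestronglyMeasurable C
    ((ae_norm_eq r).mono fun x hx => hC x (mem_closedBall_zero_iff.2 hx.le))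

variable [DecidableEq ι]

theorem rot_mul_apply (g h : orthogonalGroup ι ℝ) (x : EuclideanSpace ℝ ι) :
    rot (g * h) x = rot g (rot h x) :=
  PiLp.ext fun _ => congrFun (mulVec_mulVec x.ofLp (g : Matrix ι ι ℝ) h).symm _

theorem rot_one_apply (x : EuclideanSpace ℝ ι) : rot (1 : orthogonalGroup ι ℝ) x = x :=
  PiLp.ext fun _ => congrFun (one_mulVec x.ofLp) _

@[simp]
theorem rot_inv_rot (g : orthogonalGroup ι ℝ) (x : EuclideanSpace ℝ ι) :
    rot g⁻¹ (rot g x) = x := by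
  rw [← rot_mul_apply, inv_mul_cancel, rot_one_apply]

@[simp]
theorem rot_rot_inv (g : orthogonalGroup ι ℝ) (x : EuclideanSpace ℝ ι) :
    rot g (rot g⁻¹ x) = x := by
  rw [← rot_mul_apply, mul_inv_cancel, rot_one_apply]

theorem inner_rot_left (g : orthogonalGroup ι ℝ) (x y : EuclideanSpace ℝ ι) :
    inner ℝ (rot g x) y = inner ℝ x (rot g⁻¹ y) := by
  rw [← LinearIsometryEquiv.inner_map_map (rot g) x (rot g⁻¹ y), rot_rot_inv]

theorem integral_comp_rot {E : Type*} [NormedAddCommGroup E] [NormedSpace ℝ E] (r : ℝ)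
    (g : orthogonalGroup ι ℝ) (f : EuclideanSpace ℝ ι → E) :
    ∫ x, f (rot g x) ∂(sphereMeasure ι r) = ∫ x, f x ∂(sphereMeasure ι r) :=
  (measurePreserving_isometry r (rot g)).integral_comp
    (rot g).toHomeomorph.measurableEmbedding f

theorem ae_rot (g : orthogonalGroup ι ℝ) {p : EuclideanSpace ℝ ι → Prop}
    (h : ∀ᵐ x ∂(sphereMeasure ι r), p x) : ∀ᵐ x ∂(sphereMeasure ι r), p (rot g x) :=
  (measurePreserving_isometry r (rot g)).quasiMeasurePreserving.ae h

theorem continuous_rot_apply (x : EuclideanSpace ℝ ι) :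
    Continuous fun g : orthogonalGroup ι ℝ => rot g x :=
  (PiLp.continuous_toLp 2 _).comp
    (Continuous.matrix_mulVec continuous_subtype_val continuous_const)

theorem continuous_coe_rot :
    Continuous fun g : orthogonalGroup ι ℝ =>
      ((rot g).toContinuousLinearEquiv : EuclideanSpace ℝ ι →L[ℝ] EuclideanSpace ℝ ι) :=
  continuous_clm_apply.2 continuous_rot_apply

end Sphere

/-! ### The action of rotations on pairs of a function and a vector field -/

section Pairs

variable {ι : Type*} [Fintype ι] {r : ℝ}

variable (ι r) in
/-- Integrable vector fields on the sphere, extended to the ambient space as in `SphereL1` and not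
required to be tangential. -/
abbrev FieldL1 : Type _ := Lp (EuclideanSpace ℝ ι) 1 (sphereMeasure ι r)

variable (ι r) in
/-- Pairs `(F, G)` of an integrable function and an integrable vector field; `G` is meant to be the
weak gradient of `F`. -/
abbrev PairL1 : Type _ := SphereL1 ι r × FieldL1 ι r

variable [DecidableEq ι]

/-- The action of orthogonal matrices on vector fields: `(actField g G)(x) = g G(g⁻¹ x)`. -/
def actField (g : orthogonalGroup ι ℝ) : FieldL1 ι r →L[ℝ] FieldL1 ι r :=
  (((rot g).toContinuousLinearEquiv : EuclideanSpace ℝ ι →L[ℝ] EuclideanSpace ℝ ι).compLpL 1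
    (sphereMeasure ι r)).comp
    (Lp.compMeasurePreservingₗᵢ ℝ (rot g⁻¹)
      (measurePreserving_isometry r (rot g⁻¹))).toContinuousLinearMap

theorem actField_coeFn (g : orthogonalGroup ι ℝ) (G : FieldL1 ι r) :
    ⇑(actField g G) =ᵐ[sphereMeasure ι r] fun x => rot g (G (rot g⁻¹ x)) := by
  have hg := measurePreserving_isometry r (rot g⁻¹)
  filter_upwards [Lp.coeFn_compMeasurePreserving G hg,
    ContinuousLinearMap.coeFn_compLpL (p := 1) (μ := sphereMeasure ι r)
      ((rot g).toContinuousLinearEquiv : EuclideanSpace ℝ ι →L[ℝ] EuclideanSpace ℝ ι)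
      (Lp.compMeasurePreserving (rot g⁻¹) hg G)] with x hcomp hlin
  exact hlin.trans (congrArg (rot g) hcomp)

theorem norm_actField_le (g : orthogonalGroup ι ℝ) (G : FieldL1 ι r) :
    ‖actField g G‖ ≤ ‖G‖ := by
  refine (ContinuousLinearMap.norm_compLp_le _ _).trans ?_
  refine (mul_le_mul_of_nonneg_right
    (rot g).toLinearIsometry.norm_toContinuousLinearMap_le (norm_nonneg _)).trans ?_
  exact ((one_mul _).trans (LinearIsometry.norm_map _ G)).le

theorem continuous_actField (G : FieldL1 ι r) :
    Continuous fun g : orthogonalGroup ι ℝ => actField g G := by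
  let inv (g : orthogonalGroup ι ℝ) : C(EuclideanSpace ℝ ι, EuclideanSpace ℝ ι) :=
    ⟨rot g⁻¹, (rot g⁻¹).continuous⟩
  have hinv : Continuous inv := ContinuousMap.continuous_of_continuous_uncurry _
    ((continuous_coe_rot.comp (continuous_inv.comp continuous_fst)).clm_apply continuous_snd)
  have hcomp : Continuous fun g : orthogonalGroup ι ℝ =>
      Lp.compMeasurePreserving (rot g⁻¹) (measurePreserving_isometry r (rot g⁻¹)) G :=
    (continuous_const (y := G)).compMeasurePreservingLp hinv
      (fun g => measurePreserving_isometry r (rot g⁻¹)) ENNReal.one_ne_top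
  let comp := (ContinuousLinearMap.id ℝ (EuclideanSpace ℝ ι →L[ℝ] EuclideanSpace ℝ ι)).compLpL₂ 1
    (sphereMeasure ι r)
  exact (comp.continuous.comp continuous_coe_rot).clm_apply hcomp

/-- The simultaneous action of orthogonal matrices on functions and vector fields. -/
def actPair (g : orthogonalGroup ι ℝ) : PairL1 ι r →L[ℝ] PairL1 ι r :=
  (act g).toContinuousLinearMap.prodMap (actField g)

theorem actPair_fst (g : orthogonalGroup ι ℝ) (y : PairL1 ι r) : (actPair g y).1 = act g y.1 :=
  rfl

theorem actPair_snd (g : orthogonalGroup ι ℝ) (y : PairL1 ι r) :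
    (actPair g y).2 = actField g y.2 :=
  rfl

theorem norm_actPair_le (g : orthogonalGroup ι ℝ) (y : PairL1 ι r) : ‖actPair g y‖ ≤ ‖y‖ :=
  max_le_max (LinearIsometry.norm_map (act g) y.1).le (norm_actField_le g y.2)

theorem continuous_actPair (y : PairL1 ι r) :
    Continuous fun g : orthogonalGroup ι ℝ => actPair g y :=
  (continuous_act y.1).prodMk (continuous_actField y.2)

theorem act_mul (g h : orthogonalGroup ι ℝ) (F : SphereL1 ι r) :
    act (g * h) F = act g (act h F) := by
  refine Lp.ext ?_
  filter_upwards [act_coeFn (g * h) F, act_coeFn g (act h F), ae_rot g⁻¹ (act_coeFn h F)]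
    with x hgh hg hh
  rw [hgh, hg, hh, _root_.mul_inv_rev, rot_mul_apply]

theorem actPair_mul (g h : orthogonalGroup ι ℝ) (y : PairL1 ι r) :
    actPair (g * h) y = actPair g (actPair h y) := by
  refine Prod.ext (act_mul g h y.1) (Lp.ext ?_)
  filter_upwards [actField_coeFn (g * h) y.2, actField_coeFn g (actField h y.2),
    ae_rot g⁻¹ (actField_coeFn h y.2)] with x hgh hg hh
  simp only [actPair_snd, hgh, hg, hh, _root_.mul_inv_rev, rot_mul_apply]

theorem actPair_one (y : PairL1 ι r) : actPair 1 y = y := by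
  refine Prod.ext (Lp.ext ?_) (Lp.ext ?_)
  · filter_upwards [act_coeFn 1 y.1] with x h
    rw [actPair_fst, h, inv_one, rot_one_apply]
  · filter_upwards [actField_coeFn 1 y.2] with x h
    rw [actPair_snd, h, inv_one, rot_one_apply, rot_one_apply]

end Pairs

/-! ### Averages over random rotations -/

section Average

variable {ι : Type*} [Fintype ι] [DecidableEq ι] {r : ℝ}
variable {Ω : Type*} [TopologicalSpace Ω] [SecondCountableTopology Ω] [MeasurableSpace Ω]
  [OpensMeasurableSpace Ω] (m : Measure Ω)

theorem integrable_actPair [IsFiniteMeasure m] (γ : C(Ω, orthogonalGroup ι ℝ))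
    (y : PairL1 ι r) : Integrable (fun s => actPair (γ s) y) m :=
  .of_bound ((continuous_actPair y).comp γ.continuous).aestronglyMeasurable ‖y‖
    (.of_forall fun s => norm_actPair_le (γ s) y)

variable [IsProbabilityMeasure m]

/-- The average of the operators `actPair (γ s)` over a probability space. -/
def average (γ : C(Ω, orthogonalGroup ι ℝ)) : PairL1 ι r →L[ℝ] PairL1 ι r :=
  LinearMap.mkContinuous
    { toFun := fun y => ∫ s, actPair (γ s) y ∂m
      map_add' := fun y z => by
        simp only [map_add]
        exact integral_add (integrable_actPair m γ y) (integrable_actPair m γ z)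
      map_smul' := fun c y => by
        simp only [map_smul, RingHom.id_apply]
        exact integral_smul c _ }
    1 fun y => by
      simpa using norm_integral_le_of_norm_le_const (μ := m) (C := ‖y‖)
        (.of_forall fun s => norm_actPair_le (γ s) y)

theorem average_apply (γ : C(Ω, orthogonalGroup ι ℝ)) (y : PairL1 ι r) :
    average m γ y = ∫ s, actPair (γ s) y ∂m :=
  rfl

theorem map_average {E : Type*} [NormedAddCommGroup E] [NormedSpace ℝ E] [CompleteSpace E]
    (γ : C(Ω, orthogonalGroup ι ℝ)) (l : PairL1 ι r →L[ℝ] E) (y : PairL1 ι r) :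
    l (average m γ y) = ∫ s, l (actPair (γ s) y) ∂m :=
  (l.integral_comp_comm (integrable_actPair m γ y)).symm

theorem average_fst (γ : C(Ω, orthogonalGroup ι ℝ)) (y : PairL1 ι r) :
    (average m γ y).1 = ∫ s, act (γ s) y.1 ∂m :=
  map_average m γ (ContinuousLinearMap.fst ℝ (SphereL1 ι r) (FieldL1 ι r)) y

theorem average_mem (γ : C(Ω, orthogonalGroup ι ℝ)) {W : Submodule ℝ (PairL1 ι r)}
    (hW : IsClosed (W : Set (PairL1 ι r))) (hact : ∀ g, ∀ y ∈ W, actPair g y ∈ W)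
    {y : PairL1 ι r} (hy : y ∈ W) : average m γ y ∈ W :=
  W.convex.integral_mem hW (.of_forall fun s => hact (γ s) y hy) (integrable_actPair m γ y)

end Average

/-! ### The closed space of functions with a weak gradient -/

section WeakGradient

variable {ι : Type*} [Fintype ι] {r : ℝ}

section Pairing

variable {h : EuclideanSpace ℝ ι → EuclideanSpace ℝ ι} {k : EuclideanSpace ℝ ι → ℝ}
  (hh : MemLp h ∞ (sphereMeasure ι r)) (hk : MemLp k ∞ (sphereMeasure ι r))

include hh in
theorem integrable_inner_of_memLp_top {G : EuclideanSpace ℝ ι → EuclideanSpace ℝ ι}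
    (hG : Integrable G (sphereMeasure ι r)) :
    Integrable (fun x => inner ℝ (h x) (G x)) (sphereMeasure ι r) :=
  memLp_one_iff_integrable.1 ((innerSL ℝ).memLp_of_bilin 1 hh (memLp_one_iff_integrable.2 hG))

/-- The continuous functional on pairs given by integration against a bounded vector field `h` and
a bounded function `k`. -/
def pairing : PairL1 ι r →L[ℝ] ℝ :=
  ((innerSL ℝ).lpPairing (sphereMeasure ι r) ∞ 1 (hh.toLp h)).comp (.snd ℝ _ _) +
    ((ContinuousLinearMap.mul ℝ ℝ).lpPairing (sphereMeasure ι r) ∞ 1 (hk.toLp k)).comp (.fst ℝ _ _)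

include hh hk in
theorem integrable_pairing (y : PairL1 ι r) :
    Integrable (fun x => inner ℝ (h x) (y.2 x) + k x * y.1 x) (sphereMeasure ι r) :=
  (integrable_inner_of_memLp_top hh (L1.integrable_coeFn y.2)).add
    ((L1.integrable_coeFn y.1).mul_of_top_right hk)

theorem pairing_apply_eq_add (y : PairL1 ι r) :
    pairing hh hk y = ∫ x, inner ℝ (h x) (y.2 x) ∂(sphereMeasure ι r) +
      ∫ x, k x * y.1 x ∂(sphereMeasure ι r) := by
  simp only [pairing, _root_.add_apply, ContinuousLinearMap.comp_apply,
    ContinuousLinearMap.coe_fst', ContinuousLinearMap.coe_snd',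
    ContinuousLinearMap.lpPairing_eq_integral, ContinuousLinearMap.mul_apply']
  congr 1
  · exact integral_congr_ae (hh.coeFn_toLp.mono fun x hx => by simp only [hx]; rfl)
  · exact integral_congr_ae (hk.coeFn_toLp.mono fun x hx => by simp only [hx])

theorem pairing_apply (y : PairL1 ι r) :
    pairing hh hk y = ∫ x, (inner ℝ (h x) (y.2 x) + k x * y.1 x) ∂(sphereMeasure ι r) :=
  (pairing_apply_eq_add hh hk y).trans
    (integral_add (integrable_inner_of_memLp_top hh (L1.integrable_coeFn y.2))
      ((L1.integrable_coeFn y.1).mul_of_top_right hk)).symm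

end Pairing

variable (ι r) in
/-- The radial part `x ↦ ⟨x, G x⟩` of a vector field `G`. -/
def radialPart : FieldL1 ι r →L[ℝ] SphereL1 ι r :=
  (innerSL ℝ).holderL (sphereMeasure ι r) ∞ 1 1 ((memLp_top_of_continuous continuous_id).toLp id)

theorem radialPart_eq_zero_iff {G : FieldL1 ι r} :
    radialPart ι r G = 0 ↔ ∀ᵐ x ∂(sphereMeasure ι r), inner ℝ x (G x) = 0 := by
  have hid : MemLp id ∞ (sphereMeasure ι r) := memLp_top_of_continuous continuous_id
  have hG : ⇑(radialPart ι r G) =ᵐ[sphereMeasure ι r] fun x => inner ℝ x (G x) := by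
    filter_upwards [hid.coeFn_toLp, (innerSL ℝ).coeFn_holder (r := 1) (hid.toLp id) G]
      with x hx hholder
    exact hholder.trans (by rw [hx]; rfl)
  rw [Lp.eq_zero_iff_ae_eq_zero]
  exact ⟨fun h => hG.symm.trans h, fun h => hG.trans h⟩

variable [DecidableEq ι]

theorem continuous_rotField (i j : ι) :
    Continuous (rotField i j : EuclideanSpace ℝ ι → EuclideanSpace ℝ ι) := by
  unfold rotField
  fun_prop

section SmoothFunction

variable {φ : EuclideanSpace ℝ ι → ℝ} (hφ : ContDiff ℝ ∞ φ)

include hφ in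
theorem memLp_top_smul_rotField (i j : ι) :
    MemLp (fun x => φ x • rotField i j x) ∞ (sphereMeasure ι r) :=
  memLp_top_of_continuous (hφ.continuous.smul (continuous_rotField i j))

include hφ in
theorem memLp_top_fderiv_rotField (i j : ι) :
    MemLp (fun x => fderiv ℝ φ x (rotField i j x)) ∞ (sphereMeasure ι r) :=
  memLp_top_of_continuous ((hφ.continuous_fderiv (by simp)).clm_apply (continuous_rotField i j))

/-- The functional whose vanishing for all `i`, `j` and `φ` expresses integration by parts. -/
def byPartsDefect (i j : ι) : PairL1 ι r →L[ℝ] ℝ :=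
  pairing (memLp_top_smul_rotField hφ i j) (memLp_top_fderiv_rotField hφ i j)

theorem byPartsDefect_eq_zero_iff (i j : ι) (y : PairL1 ι r) :
    byPartsDefect hφ i j y = 0 ↔
      ∫ x, y.1 x * fderiv ℝ φ x (rotField i j x) ∂(sphereMeasure ι r) =
        -∫ x, φ x * inner ℝ (rotField i j x) (y.2 x) ∂(sphereMeasure ι r) := by
  rw [byPartsDefect, pairing_apply_eq_add, eq_neg_iff_add_eq_zero, add_comm]
  simp only [real_inner_smul_left, mul_comm]

end SmoothFunction

variable (ι r) in
/-- The graph of the weak gradient: the pairs `(F, G)` for which `G` is a weak gradient of `F`. -/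
def weakGradientGraph : Submodule ℝ (PairL1 ι r) :=
  ((radialPart ι r).comp (.snd ℝ _ _)).ker ⊓
    ⨅ (i) (j) (φ) (hφ : ContDiff ℝ ∞ φ), (byPartsDefect hφ i j).ker

theorem mem_weakGradientGraph {y : PairL1 ι r} :
    y ∈ weakGradientGraph ι r ↔ IsWeakGradient r y.1 y.2 := by
  have htangent : y ∈ ((radialPart ι r).comp (.snd ℝ _ _)).ker ↔
      ∀ᵐ x ∂(sphereMeasure ι r), inner ℝ x (y.2 x) = 0 := radialPart_eq_zero_iff
  simp only [weakGradientGraph, Submodule.mem_inf, Submodule.mem_iInf, htangent, LinearMap.mem_ker,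
    byPartsDefect_eq_zero_iff, ContinuousLinearMap.coe_coe]
  exact ⟨fun h => ⟨L1.integrable_coeFn y.2, h.1, h.2⟩, fun h => ⟨h.tangent, h.integral_eq⟩⟩

variable (ι r) in
theorem isClosed_weakGradientGraph :
    IsClosed (weakGradientGraph ι r : Set (PairL1 ι r)) := by
  simp only [weakGradientGraph, Submodule.coe_inf, Submodule.coe_iInf]
  exact (ContinuousLinearMap.isClosed_ker _).inter <| isClosed_iInter fun i => isClosed_iInter
    fun j => isClosed_iInter fun φ => isClosed_iInter fun hφ => ContinuousLinearMap.isClosed_ker _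

/-- The infinitesimal rotation in the plane spanned by two vectors. For two vectors of the standard
basis it is `rotField`. -/
def wedgeField (u v x : EuclideanSpace ℝ ι) : EuclideanSpace ℝ ι :=
  inner ℝ u x • v - inner ℝ v x • u

theorem wedgeField_eq_sum (u v x : EuclideanSpace ℝ ι) :
    wedgeField u v x = ∑ p : ι × ι, (u p.1 * v p.2) • rotField p.1 p.2 x := by
  ext k
  simp only [wedgeField, rotField, Fintype.sum_prod_type, PiLp.sub_apply, PiLp.smul_apply,
    smul_eq_mul, PiLp.inner_apply, RCLike.inner_apply, conj_trivial, WithLp.ofLp_sum,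
    Finset.sum_apply, PiLp.single_apply, mul_sub, Finset.sum_sub_distrib, Finset.sum_mul, mul_ite,
    mul_one, mul_zero, Finset.sum_ite_eq, Finset.mem_univ, if_true]
  rw [Finset.sum_comm (s := Finset.univ) (t := Finset.univ)]
  simp only [Finset.sum_ite_eq, Finset.mem_univ, if_true]
  congr 1 <;> exact Finset.sum_congr rfl fun i _ => by ring

theorem wedgeField_single (i j : ι) (x : EuclideanSpace ℝ ι) :
    wedgeField (EuclideanSpace.single i 1) (EuclideanSpace.single j 1) x = rotField i j x := by
  simp [wedgeField, rotField, EuclideanSpace.inner_single_left]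

theorem rot_wedgeField (g : orthogonalGroup ι ℝ) (u v x : EuclideanSpace ℝ ι) :
    rot g (wedgeField u v x) = wedgeField (rot g u) (rot g v) (rot g x) := by
  simp only [wedgeField, map_sub, map_smul, LinearIsometryEquiv.inner_map_map]

theorem rotField_rot (g : orthogonalGroup ι ℝ) (i j : ι) (x : EuclideanSpace ℝ ι) :
    rotField i j (rot g x) = rot g (wedgeField (rot g⁻¹ (EuclideanSpace.single i 1))
      (rot g⁻¹ (EuclideanSpace.single j 1)) x) := by
  rw [rot_wedgeField, rot_rot_inv, rot_rot_inv, wedgeField_single]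

theorem integral_wedgeField {y : PairL1 ι r} (hy : y ∈ weakGradientGraph ι r)
    (u v : EuclideanSpace ℝ ι) {φ : EuclideanSpace ℝ ι → ℝ} (hφ : ContDiff ℝ ∞ φ) :
    ∫ x, (inner ℝ (φ x • wedgeField u v x) (y.2 x) + fderiv ℝ φ x (wedgeField u v x) * y.1 x)
      ∂(sphereMeasure ι r) = 0 := by
  have hsum (x : EuclideanSpace ℝ ι) :
      inner ℝ (φ x • wedgeField u v x) (y.2 x) + fderiv ℝ φ x (wedgeField u v x) * y.1 x =
        ∑ p : ι × ι, u p.1 * v p.2 * (inner ℝ (φ x • rotField p.1 p.2 x) (y.2 x) +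
          fderiv ℝ φ x (rotField p.1 p.2 x) * y.1 x) := by
    simp only [wedgeField_eq_sum, Finset.smul_sum, smul_comm (φ x), sum_inner,
      real_inner_smul_left _ _ (_ * _), map_sum, map_smul, smul_eq_mul, Finset.sum_mul,
      ← Finset.sum_add_distrib, mul_add, mul_assoc]
  simp only [hsum]
  rw [integral_finsetSum _ fun p _ => (integrable_pairing (memLp_top_smul_rotField hφ p.1 p.2)
    (memLp_top_fderiv_rotField hφ p.1 p.2) y).const_mul _]
  refine Finset.sum_eq_zero fun p _ => ?_
  rw [integral_const_mul, ← pairing_apply (memLp_top_smul_rotField hφ p.1 p.2)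
    (memLp_top_fderiv_rotField hφ p.1 p.2)]
  exact mul_eq_zero_of_right _ ((byPartsDefect_eq_zero_iff hφ p.1 p.2 y).2
    ((mem_weakGradientGraph.1 hy).integral_eq p.1 p.2 φ hφ))

theorem actPair_mem_weakGradientGraph (g : orthogonalGroup ι ℝ) {y : PairL1 ι r}
    (hy : y ∈ weakGradientGraph ι r) : actPair g y ∈ weakGradientGraph ι r := by
  refine mem_weakGradientGraph.2 ⟨L1.integrable_coeFn _, ?_, fun i j φ hφ => ?_⟩
  · filter_upwards [actField_coeFn g y.2, ae_rot g⁻¹ (mem_weakGradientGraph.1 hy).tangent]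
      with x hact htangent
    rwa [actPair_snd, hact, ← inv_inv g, ← inner_rot_left, inv_inv]
  · have hφg : ContDiff ℝ ∞ (φ ∘ rot g) := hφ.comp (rot g).contDiff
    have hfderiv (x z : EuclideanSpace ℝ ι) :
        fderiv ℝ (φ ∘ rot g) x z = fderiv ℝ φ (rot g x) (rot g z) := by
      rw [fderiv_comp x (hφ.differentiable (by simp) _) (rot g).differentiableAt,
        LinearIsometryEquiv.fderiv]
      rfl
    rw [← byPartsDefect_eq_zero_iff hφ, byPartsDefect, pairing_apply, ← integral_comp_rot r g,
      ← integral_wedgeField hy (rot g⁻¹ (EuclideanSpace.single i 1))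
        (rot g⁻¹ (EuclideanSpace.single j 1)) hφg]
    refine integral_congr_ae ?_
    filter_upwards [ae_rot g (act_coeFn g y.1), ae_rot g (actField_coeFn g y.2)] with x hF hG
    rw [actPair_fst, actPair_snd, hF, hG, rot_inv_rot, rotField_rot, ← map_smul,
      LinearIsometryEquiv.inner_map_map, hfderiv, Function.comp_apply]

end WeakGradient

/-! ### Vectors with parallel reservoir components -/

section Parallel

theorem add_sq_le_mul_add_of_sq_le {p q e f a b : ℝ} (he : 0 ≤ e) (hf : 0 ≤ f) (ha : 0 ≤ a)
    (hb : 0 ≤ b) (hp : p ^ 2 ≤ e * a) (hq : q ^ 2 ≤ f * b) :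
    (p + q) ^ 2 ≤ (e + f) * (a + b) := by
  simpa using Finset.sum_sq_le_sum_mul_sum_of_sq_le_mul (Finset.univ : Finset (Fin 2))
    (r := ![p, q]) (f := ![e, f]) (g := ![a, b])
    (by simp [Fin.forall_fin_two, *]) (by simp [Fin.forall_fin_two, *])
    (by simp [Fin.forall_fin_two, *])

theorem two_mul_sub_le_div {m n q f : ℝ} (hf : 0 < f) (hn : 0 ≤ n) (hq : 0 ≤ q)
    (h : m ^ 2 ≤ n * q) : 2 * m - n * f ≤ q / f := by
  have hmul : m ^ 2 ≤ n * f * (q / f) := by rwa [mul_assoc, mul_div_cancel₀ _ hf.ne']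
  have := two_mul_le_add_of_sq_le_mul (by positivity) (by positivity) hmul
  linarith

section Inner

variable {V W : Type*} [NormedAddCommGroup V] [InnerProductSpace ℝ V] [NormedAddCommGroup W]
  [InnerProductSpace ℝ W]

theorem inner_sq_le_norm_sq_mul_norm_sq (x y : V) : inner ℝ x y ^ 2 ≤ ‖x‖ ^ 2 * ‖y‖ ^ 2 := by
  rw [← mul_pow]
  exact sq_le_sq.2 ((abs_real_inner_le_norm x y).trans (le_abs_self _))

theorem inner_sq_mul_norm_sq_of_parallel {y η : W} (hpar : ‖y‖ ^ 2 • η = inner ℝ y η • y) (ξ : W) :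
    inner ℝ η ξ ^ 2 * ‖y‖ ^ 2 = ‖η‖ ^ 2 * inner ℝ y ξ ^ 2 := by
  rcases eq_or_ne y 0 with rfl | hy
  · simp
  have hξ : ‖y‖ ^ 2 * inner ℝ η ξ = inner ℝ y η * inner ℝ y ξ := by
    simpa only [real_inner_smul_left] using congrArg (fun z => inner ℝ z ξ) hpar
  have hη : ‖y‖ ^ 2 * ‖η‖ ^ 2 = inner ℝ y η * inner ℝ y η := by
    simpa only [real_inner_smul_left, real_inner_self_eq_norm_sq] using
      congrArg (fun z => inner ℝ z η) hpar
  refine mul_left_cancel₀ (pow_ne_zero 2 (norm_ne_zero_iff.2 hy)) ?_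
  linear_combination (‖y‖ ^ 2 * inner ℝ η ξ + inner ℝ y η * inner ℝ y ξ) * hξ -
    inner ℝ y ξ ^ 2 * hη

/-- Orthogonality trades the pairing of `ξ₂` with `y` for the pairing of `ξ₁` with `x`. -/
theorem inner_sq_mul_add_norm_sq_le_of_parallel {x ξ₁ : V} {y ξ₂ η : W}
    (hpar : ‖y‖ ^ 2 • η = inner ℝ y η • y) (horth : inner ℝ x ξ₁ + inner ℝ y ξ₂ = 0) :
    inner ℝ η ξ₂ ^ 2 * (‖x‖ ^ 2 + ‖y‖ ^ 2) ≤ ‖η‖ ^ 2 * (‖x‖ ^ 2 * (‖ξ₁‖ ^ 2 + ‖ξ₂‖ ^ 2)) := by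
  calc inner ℝ η ξ₂ ^ 2 * (‖x‖ ^ 2 + ‖y‖ ^ 2)
      = inner ℝ η ξ₂ ^ 2 * ‖x‖ ^ 2 + ‖η‖ ^ 2 * inner ℝ x ξ₁ ^ 2 := by
        rw [mul_add, inner_sq_mul_norm_sq_of_parallel hpar, eq_neg_of_add_eq_zero_left horth,
          neg_sq]
    _ ≤ ‖η‖ ^ 2 * ‖ξ₂‖ ^ 2 * ‖x‖ ^ 2 + ‖η‖ ^ 2 * (‖x‖ ^ 2 * ‖ξ₁‖ ^ 2) := by
        gcongr <;> exact inner_sq_le_norm_sq_mul_norm_sq _ _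
    _ = ‖η‖ ^ 2 * (‖x‖ ^ 2 * (‖ξ₁‖ ^ 2 + ‖ξ₂‖ ^ 2)) := by ring

theorem add_inner_sq_le_of_parallel {x ξ₁ η₁ : V} {y ξ₂ η₂ : W}
    (hpar : ‖y‖ ^ 2 • η₂ = inner ℝ y η₂ • y) (horth : inner ℝ x ξ₁ + inner ℝ y ξ₂ = 0)
    (hxy : 0 < ‖x‖ ^ 2 + ‖y‖ ^ 2) :
    (inner ℝ η₁ ξ₁ + inner ℝ η₂ ξ₂) ^ 2 ≤ (‖η₁‖ ^ 2 + ‖η₂‖ ^ 2) *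
      (‖ξ₁‖ ^ 2 + ‖x‖ ^ 2 * (‖ξ₁‖ ^ 2 + ‖ξ₂‖ ^ 2) / (‖x‖ ^ 2 + ‖y‖ ^ 2)) := by
  refine add_sq_le_mul_add_of_sq_le (by positivity) (by positivity) (by positivity)
    (by positivity) ?_ ?_
  · exact inner_sq_le_norm_sq_mul_norm_sq _ _
  · rw [← mul_div_assoc, le_div_iff₀ hxy]
    exact inner_sq_mul_add_norm_sq_le_of_parallel hpar horth

end Inner

variable {α β : Type*}

/-- The component in `ℝ^α` of a vector of `ℝ^α × ℝ^β`. -/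
def inlPart (x : EuclideanSpace ℝ (α ⊕ β)) : EuclideanSpace ℝ α := .toLp 2 fun i => x (.inl i)

/-- The component in `ℝ^β` of a vector of `ℝ^α × ℝ^β`. -/
def inrPart (x : EuclideanSpace ℝ (α ⊕ β)) : EuclideanSpace ℝ β := .toLp 2 fun j => x (.inr j)

variable [Fintype β]

theorem norm_sq_smul_inrPart_of_parallel {x η : EuclideanSpace ℝ (α ⊕ β)}
    (hpar : ∀ i j : β, x (.inr i) * η (.inr j) = x (.inr j) * η (.inr i)) :
    ‖inrPart x‖ ^ 2 • inrPart η = inner ℝ (inrPart x) (inrPart η) • inrPart x := by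
  ext j
  simp only [PiLp.smul_apply, smul_eq_mul, EuclideanSpace.real_norm_sq_eq, PiLp.inner_apply,
    RCLike.inner_apply, conj_trivial, inrPart, Finset.sum_mul]
  exact Finset.sum_congr rfl fun i _ => by linear_combination x (.inr i) * hpar i j

variable [Fintype α]

theorem inner_eq_add_inner_parts (x y : EuclideanSpace ℝ (α ⊕ β)) :
    inner ℝ x y = inner ℝ (inlPart x) (inlPart y) + inner ℝ (inrPart x) (inrPart y) := by
  simp only [PiLp.inner_apply, Fintype.sum_sum_type, inlPart, inrPart]

theorem norm_sq_eq_add_norm_sq_parts (x : EuclideanSpace ℝ (α ⊕ β)) :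
    ‖x‖ ^ 2 = ‖inlPart x‖ ^ 2 + ‖inrPart x‖ ^ 2 := by
  simp only [← real_inner_self_eq_norm_sq, inner_eq_add_inner_parts x]

theorem inner_sq_le_of_parallel {x η ξ : EuclideanSpace ℝ (α ⊕ β)} (hx : x ≠ 0)
    (hpar : ∀ i j : β, x (.inr i) * η (.inr j) = x (.inr j) * η (.inr i))
    (horth : inner ℝ x ξ = 0) :
    inner ℝ η ξ ^ 2 ≤
      ‖η‖ ^ 2 * ∑ i : α, (ξ (.inl i) ^ 2 + (‖ξ‖ / ‖x‖) ^ 2 * x (.inl i) ^ 2) := by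
  have hnorm : 0 < ‖inlPart x‖ ^ 2 + ‖inrPart x‖ ^ 2 := by
    rw [← norm_sq_eq_add_norm_sq_parts]
    positivity
  rw [inner_eq_add_inner_parts] at horth
  convert add_inner_sq_le_of_parallel (η₁ := inlPart η) (norm_sq_smul_inrPart_of_parallel hpar)
    horth hnorm using 2
  · rw [inner_eq_add_inner_parts]
  · rw [norm_sq_eq_add_norm_sq_parts]
  · rw [← norm_sq_eq_add_norm_sq_parts, ← norm_sq_eq_add_norm_sq_parts, Finset.sum_add_distrib,
      ← Finset.mul_sum, div_pow, mul_comm (‖inlPart x‖ ^ 2), mul_div_right_comm]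
    simp only [EuclideanSpace.real_norm_sq_eq, inlPart]

end Parallel

/-! ### The Fisher operator -/

section Fisher

variable {ι : Type*} [Fintype ι] {r : ℝ}

/-- The value `∫ |G|² / F dσ` of the Fisher information at a pair `(F, G)`. -/
def fisherIntegral (y : PairL1 ι r) : ℝ≥0∞ :=
  ∫⁻ x, ‖y.2 x‖ₑ ^ 2 / ENNReal.ofReal (y.1 x) ∂(sphereMeasure ι r)

/-- A pair `(F, G)` with `F ≥ 0` and finite `∫ |G|² / F dσ`, stated for the real-valued integrand:
since `v / 0 = 0` there, the vanishing of `G` where `F = 0` has to be added. -/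
structure HasFiniteFisher (y : PairL1 ι r) : Prop where
  nonneg : ∀ᵐ x ∂(sphereMeasure ι r), 0 ≤ y.1 x
  eq_zero : ∀ᵐ x ∂(sphereMeasure ι r), y.1 x = 0 → y.2 x = 0
  integrable : Integrable (fun x => ‖y.2 x‖ ^ 2 / y.1 x) (sphereMeasure ι r)

theorem ofReal_norm_sq_div {E : Type*} [NormedAddCommGroup E] {f : ℝ} (hf : 0 ≤ f) {v : E}
    (hv : f = 0 → v = 0) :
    ENNReal.ofReal (‖v‖ ^ 2 / f) = ‖v‖ₑ ^ 2 / ENNReal.ofReal f := by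
  rcases hf.eq_or_lt with rfl | hpos
  · simp [hv rfl]
  · rw [ENNReal.ofReal_div_of_pos hpos, ENNReal.ofReal_pow (norm_nonneg v), ofReal_norm]

theorem aestronglyMeasurable_norm_sq_div (y : PairL1 ι r) :
    AEStronglyMeasurable (fun x => ‖y.2 x‖ ^ 2 / y.1 x) (sphereMeasure ι r) :=
  ((Lp.aestronglyMeasurable y.2).norm.pow 2).div₀ (Lp.aestronglyMeasurable y.1)

theorem hasFiniteFisher_of_fisherIntegral_ne_top {y : PairL1 ι r}
    (hF : ∀ᵐ x ∂(sphereMeasure ι r), 0 ≤ y.1 x) (hy : fisherIntegral y ≠ ⊤) :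
    HasFiniteFisher y := by
  have hmeas : AEMeasurable (fun x => ‖y.2 x‖ₑ ^ 2 / ENNReal.ofReal (y.1 x)) (sphereMeasure ι r) :=
    ((Lp.aestronglyMeasurable y.2).enorm.pow_const 2).div
      (Lp.aestronglyMeasurable y.1).aemeasurable.ennreal_ofReal
  have hzero : ∀ᵐ x ∂(sphereMeasure ι r), y.1 x = 0 → y.2 x = 0 := by
    filter_upwards [ae_lt_top' hmeas hy] with x hx h0
    by_contra hne
    simp [h0, ENNReal.div_zero, hne] at hx
  refine ⟨hF, hzero, aestronglyMeasurable_norm_sq_div y, ?_⟩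
  refine (lintegral_congr_ae ?_).trans_lt hy.lt_top
  filter_upwards [hF, hzero] with x hx hx0
  rw [← ofReal_norm_sq_div hx hx0, Real.enorm_of_nonneg (by positivity)]

theorem HasFiniteFisher.fisherIntegral_eq {y : PairL1 ι r} (hy : HasFiniteFisher y) :
    fisherIntegral y = ENNReal.ofReal (∫ x, ‖y.2 x‖ ^ 2 / y.1 x ∂(sphereMeasure ι r)) := by
  rw [ofReal_integral_eq_lintegral_ofReal hy.integrable
    (hy.nonneg.mono fun x hx => by dsimp only [Pi.zero_apply]; positivity)]
  refine lintegral_congr_ae ?_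
  filter_upwards [hy.nonneg, hy.eq_zero] with x hx hx0
  exact (ofReal_norm_sq_div hx hx0).symm

/-- The value at `x` of the integrand of `fisherOperator` for `F x = f` and `G x = ξ`. -/
def fisherDensity (r f : ℝ) (x ξ : EuclideanSpace ℝ ι) :
    EuclideanSpace ℝ ι →L[ℝ] EuclideanSpace ℝ ι :=
  f⁻¹ • (InnerProductSpace.rankOne ℝ ξ ξ + (‖ξ‖ / r) ^ 2 • InnerProductSpace.rankOne ℝ x x)

/-- The operator `∫ (G ⊗ G + |G|² (x ⊗ x) / r²) / F dσ`, of trace `2 ∫ |G|² / F dσ` for `r ≠ 0`. -/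
def fisherOperator (y : PairL1 ι r) : EuclideanSpace ℝ ι →L[ℝ] EuclideanSpace ℝ ι :=
  ∫ x, fisherDensity r (y.1 x) x (y.2 x) ∂(sphereMeasure ι r)

theorem norm_fisherDensity_le {f : ℝ} {x : EuclideanSpace ℝ ι} (hx : ‖x‖ = |r|)
    (ξ : EuclideanSpace ℝ ι) : ‖fisherDensity r f x ξ‖ ≤ 2 * ‖‖ξ‖ ^ 2 / f‖ := by
  have hradial : ‖(‖ξ‖ / r) ^ 2 • InnerProductSpace.rankOne ℝ x x‖ ≤ ‖ξ‖ ^ 2 := by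
    rw [norm_smul, InnerProductSpace.norm_rankOne, ← sq, norm_pow, norm_div, norm_norm,
      Real.norm_eq_abs, hx, ← mul_pow]
    gcongr
    exact (div_mul_eq_mul_div _ _ _).trans_le
      (div_le_of_le_mul₀ (abs_nonneg r) (norm_nonneg ξ) le_rfl)
  have hsum := norm_add_le_of_le
    (InnerProductSpace.norm_rankOne (𝕜 := ℝ) ξ ξ).le hradial
  rw [fisherDensity, norm_smul, norm_inv]
  calc _ ≤ ‖f‖⁻¹ * (‖ξ‖ * ‖ξ‖ + ‖ξ‖ ^ 2) := by gcongr
    _ = 2 * ‖‖ξ‖ ^ 2 / f‖ := by rw [norm_div, norm_pow, norm_norm]; ring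

theorem continuous_rankOne_self : Continuous fun x : EuclideanSpace ℝ ι =>
    InnerProductSpace.rankOne ℝ x x :=
  (InnerProductSpace.rankOne ℝ).continuous.clm_apply continuous_id

theorem HasFiniteFisher.integrable_fisherDensity {y : PairL1 ι r} (hy : HasFiniteFisher y) :
    Integrable (fun x => fisherDensity r (y.1 x) x (y.2 x)) (sphereMeasure ι r) := by
  refine (hy.integrable.norm.const_mul 2).mono' ?_
    ((ae_norm_eq r).mono fun x hx => norm_fisherDensity_le hx _)
  have hG : AEStronglyMeasurable y.2 (sphereMeasure ι r) := Lp.aestronglyMeasurable y.2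
  exact (Lp.aestronglyMeasurable y.1).inv₀.smul
    ((continuous_rankOne_self.comp_aestronglyMeasurable hG).add
      (((hG.norm.div₀ aestronglyMeasurable_const).pow 2).smul
        continuous_rankOne_self.aestronglyMeasurable))

variable [DecidableEq ι]

/-- The `a`-th diagonal entry of `g A g⁻¹`, as a functional of the operator `A`. -/
def rotatedDiag (g : orthogonalGroup ι ℝ) (a : ι) :
    (EuclideanSpace ℝ ι →L[ℝ] EuclideanSpace ℝ ι) →L[ℝ] ℝ :=
  (innerSL ℝ (rot g⁻¹ (EuclideanSpace.single a 1))).comp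
    (.apply ℝ _ (rot g⁻¹ (EuclideanSpace.single a 1)))

theorem rotatedDiag_apply (g : orthogonalGroup ι ℝ) (a : ι)
    (A : EuclideanSpace ℝ ι →L[ℝ] EuclideanSpace ℝ ι) :
    rotatedDiag g a A = inner ℝ (rot g⁻¹ (EuclideanSpace.single a 1))
      (A (rot g⁻¹ (EuclideanSpace.single a 1))) :=
  rfl

theorem inner_rot_inv_single (g : orthogonalGroup ι ℝ) (a : ι) (x : EuclideanSpace ℝ ι) :
    inner ℝ (rot g⁻¹ (EuclideanSpace.single a 1)) x = rot g x a := by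
  rw [inner_rot_left, inv_inv, EuclideanSpace.inner_single_left, map_one, one_mul]

theorem rotatedDiag_fisherDensity (g : orthogonalGroup ι ℝ) (a : ι) (f : ℝ)
    (x ξ : EuclideanSpace ℝ ι) :
    rotatedDiag g a (fisherDensity r f x ξ) =
      (rot g ξ a ^ 2 + (‖ξ‖ / r) ^ 2 * rot g x a ^ 2) / f := by
  rw [rotatedDiag_apply, fisherDensity, _root_.smul_apply, _root_.add_apply,
    _root_.smul_apply, InnerProductSpace.rankOne_apply,
    InnerProductSpace.rankOne_apply, real_inner_smul_right, inner_add_right, real_inner_smul_right,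
    real_inner_smul_right, real_inner_smul_right, real_inner_comm (rot g⁻¹ _),
    real_inner_comm (rot g⁻¹ _), inner_rot_inv_single, inner_rot_inv_single]
  ring

theorem HasFiniteFisher.rotatedDiag_fisherOperator {y : PairL1 ι r} (hy : HasFiniteFisher y)
    (g : orthogonalGroup ι ℝ) (a : ι) :
    rotatedDiag g a (fisherOperator y) =
      ∫ x, rotatedDiag g a (fisherDensity r (y.1 x) x (y.2 x)) ∂(sphereMeasure ι r) :=
  ((rotatedDiag g a).integral_comp_comm hy.integrable_fisherDensity).symm

theorem HasFiniteFisher.rotatedDiag_fisherOperator_nonneg {y : PairL1 ι r}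
    (hy : HasFiniteFisher y) (g : orthogonalGroup ι ℝ) (a : ι) :
    0 ≤ rotatedDiag g a (fisherOperator y) := by
  rw [hy.rotatedDiag_fisherOperator]
  refine integral_nonneg_of_ae (hy.nonneg.mono fun x hx => ?_)
  dsimp only [Pi.zero_apply]
  rw [rotatedDiag_fisherDensity]
  positivity

theorem sum_rotatedDiag_fisherDensity (hr : r ≠ 0) (g : orthogonalGroup ι ℝ) (f : ℝ)
    {x : EuclideanSpace ℝ ι} (hx : ‖x‖ = |r|) (ξ : EuclideanSpace ℝ ι) :
    ∑ a, rotatedDiag g a (fisherDensity r f x ξ) = 2 * (‖ξ‖ ^ 2 / f) := by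
  simp only [rotatedDiag_fisherDensity]
  rw [← Finset.sum_div, Finset.sum_add_distrib, ← Finset.mul_sum, ← EuclideanSpace.real_norm_sq_eq,
    ← EuclideanSpace.real_norm_sq_eq, LinearIsometryEquiv.norm_map, LinearIsometryEquiv.norm_map,
    hx, sq_abs, div_pow, div_mul_cancel₀ _ (pow_ne_zero 2 hr)]
  ring

theorem HasFiniteFisher.sum_rotatedDiag_fisherOperator (hr : r ≠ 0) {y : PairL1 ι r}
    (hy : HasFiniteFisher y) (g : orthogonalGroup ι ℝ) :
    ∑ a, rotatedDiag g a (fisherOperator y) =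
      2 * ∫ x, ‖y.2 x‖ ^ 2 / y.1 x ∂(sphereMeasure ι r) := by
  rw [← integral_const_mul]
  simp only [hy.rotatedDiag_fisherOperator]
  rw [← integral_finsetSum _ fun a _ =>
    (rotatedDiag g a).integrable_comp hy.integrable_fisherDensity]
  exact integral_congr_ae ((ae_norm_eq r).mono fun x hx =>
    sum_rotatedDiag_fisherDensity hr g _ hx _)

end Fisher

/-! ### The dual functional of the Fisher information -/

section Dual

variable {ι : Type*} [Fintype ι] {r : ℝ} {h : EuclideanSpace ℝ ι → EuclideanSpace ℝ ι}
  (hh : MemLp h ∞ (sphereMeasure ι r))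

include hh in
theorem memLp_top_neg_norm_sq : MemLp (fun x => -‖h x‖ ^ 2) ∞ (sphereMeasure ι r) := by
  simp only [sq]
  exact (MemLp.mul (r := ∞) hh.norm hh.norm).neg

/-- The functional `(F, G) ↦ ∫ (2 ⟪h, G⟫ - |h|² F) dσ` for a bounded vector field `h`; by duality
`∫ |G|² / F dσ` is its supremum over `h`, attained at `h = G / F`. -/
def fisherFunctional : PairL1 ι r →L[ℝ] ℝ :=
  pairing (hh.const_smul (2 : ℝ)) (memLp_top_neg_norm_sq hh)

theorem fisherFunctional_apply (y : PairL1 ι r) :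
    fisherFunctional hh y =
      ∫ x, (2 * inner ℝ (h x) (y.2 x) - ‖h x‖ ^ 2 * y.1 x) ∂(sphereMeasure ι r) := by
  simp only [fisherFunctional, pairing_apply, Pi.smul_apply, real_inner_smul_left, neg_mul,
    ← sub_eq_add_neg]

include hh in
theorem integrable_fisherFunctional (y : PairL1 ι r) :
    Integrable (fun x => 2 * inner ℝ (h x) (y.2 x) - ‖h x‖ ^ 2 * y.1 x) (sphereMeasure ι r) := by
  simpa only [Pi.smul_apply, real_inner_smul_left, neg_mul, ← sub_eq_add_neg] using
    integrable_pairing (hh.const_smul (2 : ℝ)) (memLp_top_neg_norm_sq hh) y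

end Dual

section DualSum

variable {α β : Type*} [Fintype α] [Fintype β] [DecidableEq α] [DecidableEq β] {r : ℝ}

theorem two_mul_inner_sub_le (hr : r ≠ 0) {g : orthogonalGroup (α ⊕ β) ℝ}
    {x η ξ : EuclideanSpace ℝ (α ⊕ β)} {f : ℝ} (hf : 0 < f) (hx : ‖x‖ = |r|)
    (horth : inner ℝ x ξ = 0)
    (hpar : ∀ i j : β, rot g x (.inr i) * η (.inr j) = rot g x (.inr j) * η (.inr i)) :
    2 * inner ℝ η (rot g ξ) - ‖η‖ ^ 2 * f ≤
      ∑ i : α, rotatedDiag g (.inl i) (fisherDensity r f x ξ) := by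
  have hne : rot g x ≠ 0 := by
    rwa [← norm_ne_zero_iff, LinearIsometryEquiv.norm_map, hx, abs_ne_zero]
  have hle := inner_sq_le_of_parallel hne hpar
    ((LinearIsometryEquiv.inner_map_map (rot g) x ξ).trans horth)
  rw [LinearIsometryEquiv.norm_map, LinearIsometryEquiv.norm_map, hx] at hle
  simp only [div_pow, sq_abs] at hle
  simp only [rotatedDiag_fisherDensity, ← Finset.sum_div, div_pow]
  exact two_mul_sub_le_div hf (sq_nonneg _) (by positivity) hle

theorem HasFiniteFisher.fisherFunctional_actPair_le (hr : r ≠ 0) {y : PairL1 (α ⊕ β) r}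
    (hy : HasFiniteFisher y)
    (htangent : ∀ᵐ x ∂(sphereMeasure (α ⊕ β) r), inner ℝ x (y.2 x) = 0)
    {h : EuclideanSpace ℝ (α ⊕ β) → EuclideanSpace ℝ (α ⊕ β)}
    (hh : MemLp h ∞ (sphereMeasure (α ⊕ β) r))
    (hpar : ∀ᵐ x ∂(sphereMeasure (α ⊕ β) r), ∀ i j : β,
      x (.inr i) * h x (.inr j) = x (.inr j) * h x (.inr i))
    (g : orthogonalGroup (α ⊕ β) ℝ) :
    fisherFunctional hh (actPair g y) ≤ ∑ i : α, rotatedDiag g (.inl i) (fisherOperator y) := by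
  have hdensity (i : α) := (rotatedDiag g (.inl i)).integrable_comp hy.integrable_fisherDensity
  simp only [hy.rotatedDiag_fisherOperator]
  rw [fisherFunctional_apply, ← integral_comp_rot r g, ← integral_finsetSum _ fun i _ => hdensity i]
  refine integral_mono_ae ((measurePreserving_isometry r (rot g)).integrable_comp_of_integrable
    (integrable_fisherFunctional hh _)) (integrable_finsetSum _ fun i _ => hdensity i) ?_
  filter_upwards [hy.nonneg, hy.eq_zero, htangent, ae_rot g hpar, ae_norm_eq r,
    ae_rot g (act_coeFn g y.1), ae_rot g (actField_coeFn g y.2)] with x hF hG0 horth hpar hx hact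
    hactField
  rw [actPair_fst, actPair_snd, hact, hactField, rot_inv_rot]
  rcases hF.eq_or_lt with h0 | hpos
  · simp [← h0, hG0 h0.symm, fisherDensity]
  · exact two_mul_inner_sub_le hr hpos hx horth hpar

end DualSum

/-! ### Exponentials of bounded operators -/

section Exp

variable {X Y : Type*} [NormedAddCommGroup X] [NormedSpace ℝ X] [CompleteSpace X]
  [NormedAddCommGroup Y] [NormedSpace ℝ Y] [CompleteSpace Y]

theorem hasSum_exp_apply (A : X →L[ℝ] X) (x : X) :
    HasSum (fun n : ℕ => (n.factorial : ℝ)⁻¹ • (A ^ n) x) (NormedSpace.exp A x) := by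
  simpa only [ContinuousLinearMap.apply_apply, _root_.smul_apply] using
    (ContinuousLinearMap.apply ℝ X x).hasSum (NormedSpace.exp_series_hasSum_exp' (𝕂 := ℝ) A)

theorem map_exp_apply {A : X →L[ℝ] X} {B : Y →L[ℝ] Y} (T : X →L[ℝ] Y)
    (hT : ∀ x, T (A x) = B (T x)) (x : X) :
    T (NormedSpace.exp A x) = NormedSpace.exp B (T x) := by
  have hpow (n : ℕ) : T ((A ^ n) x) = (B ^ n) (T x) := by
    rw [FunLike.coe_pow_eq_iterate, FunLike.coe_pow_eq_iterate]
    exact (Function.Semiconj.iterate_right hT n) x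
  refine (T.hasSum (hasSum_exp_apply A x)).unique ?_
  simpa only [map_smul, hpow] using hasSum_exp_apply B (T x)

theorem exp_apply_of_eq_smul {A : X →L[ℝ] X} {x : X} {c : ℝ} (hx : A x = c • x) :
    NormedSpace.exp A x = Real.exp c • x := by
  have hpow (n : ℕ) : (A ^ n) x = c ^ n • x := by
    induction n with
    | zero => simp
    | succ n ih => rw [pow_succ', mul_apply_eq_comp, ih, map_smul, hx, smul_smul, pow_succ]
  have hexp := (NormedSpace.exp_series_hasSum_exp' (𝕂 := ℝ) c).smul_const x
  rw [← Real.exp_eq_exp_ℝ] at hexp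
  refine (hasSum_exp_apply A x).unique ?_
  simpa only [hpow, smul_smul, smul_eq_mul] using hexp

theorem exp_apply_mem {A : X →L[ℝ] X} {W : Submodule ℝ X} (hW : IsClosed (W : Set X))
    (hA : ∀ x ∈ W, A x ∈ W) {x : X} (hx : x ∈ W) : NormedSpace.exp A x ∈ W := by
  have hpow (n : ℕ) : (A ^ n) x ∈ W := by
    induction n with
    | zero => simpa
    | succ n ih =>
      rw [pow_succ', mul_apply_eq_comp]
      exact hA _ ih
  exact hW.mem_of_tendsto (hasSum_exp_apply A x)
    (.of_forall fun s => W.sum_mem fun n _ => W.smul_mem _ (hpow n))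

theorem exp_smul_sub_smul_one (A : X →L[ℝ] X) (c t : ℝ) :
    NormedSpace.exp (t • (A - c • (1 : X →L[ℝ] X))) =
      Real.exp (-(t * c)) • NormedSpace.exp (t • A) := by
  let +nondep : NormedAlgebra ℚ (X →L[ℝ] X) := .restrictScalars ℚ ℝ _
  have hsplit : t • (A - c • (1 : X →L[ℝ] X)) =
      t • A + algebraMap ℝ (X →L[ℝ] X) (-(t * c)) := by
    rw [Algebra.algebraMap_eq_smul_one]
    module
  rw [hsplit, NormedSpace.exp_add_of_commute (Algebra.commutes _ _).symm,
    ← NormedSpace.algebraMap_exp_comm, ← Real.exp_eq_exp_ℝ, Algebra.algebraMap_eq_smul_one,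
    mul_smul_comm, mul_one]

theorem apply_exp_smul_le {A : X →L[ℝ] X} {B : Y →L[ℝ] Y} {l : X →L[ℝ] ℝ} {m : Y →L[ℝ] ℝ}
    {x : X} {y : Y} (h : ∀ n : ℕ, l ((A ^ n) x) ≤ m ((B ^ n) y)) {t : ℝ} (ht : 0 ≤ t) :
    l (NormedSpace.exp (t • A) x) ≤ m (NormedSpace.exp (t • B) y) := by
  refine hasSum_le (fun n => ?_) (l.hasSum (hasSum_exp_apply (t • A) x))
    (m.hasSum (hasSum_exp_apply (t • B) y))
  simp only [smul_pow, _root_.smul_apply, map_smul, smul_eq_mul]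
  gcongr
  exact h n

end Exp

/-! ### Random collisions -/

section Collision

variable {ι : Type*} [DecidableEq ι]

/-- The exchange `z ↦ (z j - z i) (e_i - e_j)` of weights between `i` and `j`. -/
def exchange (i j : ι) : (ι → ℝ) →L[ℝ] (ι → ℝ) :=
  (ContinuousLinearMap.proj (R := ℝ) (φ := fun _ : ι => ℝ) j - .proj i).smulRight
    (Pi.single i 1 - Pi.single j 1)

theorem exchange_apply (i j : ι) (z : ι → ℝ) :
    exchange i j z = (z j - z i) • (Pi.single i 1 - Pi.single j 1) :=
  rfl

variable [Fintype ι] {r : ℝ}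

/-- The averaged collision operator `R_{ij}` on pairs. -/
def collisionPair (ν : Measure ℝ) [IsProbabilityMeasure ν] (i j : ι) :
    PairL1 ι r →L[ℝ] PairL1 ι r :=
  average ν ⟨planeRotation i j, continuous_planeRotation i j⟩

theorem collisionPair_fst (ν : Measure ℝ) [IsProbabilityMeasure ν] (i j : ι) (y : PairL1 ι r) :
    (collisionPair ν i j y).1 = collision ν i j y.1 :=
  average_fst ν _ y

theorem rot_planeRotation_inv_single_left {i j : ι} (h : i ≠ j) (θ : ℝ) :
    rot (planeRotation i j θ)⁻¹ (EuclideanSpace.single i 1) =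
      Real.cos θ • EuclideanSpace.single i 1 + Real.sin θ • EuclideanSpace.single j 1 := by
  ext k
  rw [rot_planeRotation_inv h]
  by_cases hi : k = i <;> by_cases hj : k = j <;> simp_all [h.symm]

theorem rot_planeRotation_inv_single_right {i j : ι} (h : i ≠ j) (θ : ℝ) :
    rot (planeRotation i j θ)⁻¹ (EuclideanSpace.single j 1) =
      Real.cos θ • EuclideanSpace.single j 1 - Real.sin θ • EuclideanSpace.single i 1 := by
  ext k
  rw [rot_planeRotation_inv h]
  by_cases hi : k = i <;> by_cases hj : k = j <;> simp_all [h.symm]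

theorem rot_planeRotation_inv_single_of_ne {i j a : ι} (h : i ≠ j) (hi : a ≠ i) (hj : a ≠ j)
    (θ : ℝ) :
    rot (planeRotation i j θ)⁻¹ (EuclideanSpace.single a 1) = EuclideanSpace.single a 1 := by
  ext k
  rw [rot_planeRotation_inv h]
  by_cases hi : k = i <;> by_cases hj : k = j <;> simp_all

theorem planeRotation_self (i : ι) (θ : ℝ) : planeRotation i i θ = 1 :=
  dif_neg fun h => h rfl

theorem integrable_sin_sq (ν : Measure ℝ) [IsFiniteMeasure ν] :
    Integrable (fun θ => Real.sin θ ^ 2) ν :=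
  .of_bound (by fun_prop) 1 (.of_forall fun θ => by
    rw [Real.norm_of_nonneg (sq_nonneg _)]
    exact Real.sin_sq_le_one θ)

theorem integrable_sin_mul_cos (ν : Measure ℝ) [IsFiniteMeasure ν] :
    Integrable (fun θ => Real.sin θ * Real.cos θ) ν :=
  .of_bound (by fun_prop) 1 (.of_forall fun θ => by
    rw [norm_mul]
    exact mul_le_one₀ (Real.abs_sin_le_one θ) (norm_nonneg _) (Real.abs_cos_le_one θ))

/-- The functional `z ↦ ∑ a, z a (g A g⁻¹)_{aa}` on weights. -/
def weightedDiag (A : EuclideanSpace ℝ ι →L[ℝ] EuclideanSpace ℝ ι) (g : orthogonalGroup ι ℝ) :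
    (ι → ℝ) →L[ℝ] ℝ :=
  ∑ a, rotatedDiag g a A • ContinuousLinearMap.proj a

theorem weightedDiag_apply (A : EuclideanSpace ℝ ι →L[ℝ] EuclideanSpace ℝ ι)
    (g : orthogonalGroup ι ℝ) (z : ι → ℝ) :
    weightedDiag A g z = ∑ a, rotatedDiag g a A * z a := by
  simp only [weightedDiag, _root_.sum_apply, _root_.smul_apply, ContinuousLinearMap.proj_apply,
    smul_eq_mul]

theorem weightedDiag_exchange (A : EuclideanSpace ℝ ι →L[ℝ] EuclideanSpace ℝ ι)
    (g : orthogonalGroup ι ℝ) (i j : ι) (z : ι → ℝ) :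
    weightedDiag A g (exchange i j z) =
      (z j - z i) * (rotatedDiag g i A - rotatedDiag g j A) := by
  simp [exchange_apply, weightedDiag_apply, Pi.single_apply, mul_sub]

theorem exists_weightedDiag_planeRotation_mul (A : EuclideanSpace ℝ ι →L[ℝ] EuclideanSpace ℝ ι)
    (g : orthogonalGroup ι ℝ) (i j : ι) (z : ι → ℝ) :
    ∃ c : ℝ, ∀ θ, weightedDiag A (planeRotation i j θ * g) z = weightedDiag A g z +
      weightedDiag A g (exchange i j z) * Real.sin θ ^ 2 + c * (Real.sin θ * Real.cos θ) := by
  rcases eq_or_ne i j with rfl | h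
  · exact ⟨0, fun θ => by simp [planeRotation_self, exchange_apply]⟩
  set u := rot g⁻¹ (EuclideanSpace.single i 1)
  set v := rot g⁻¹ (EuclideanSpace.single j 1)
  refine ⟨(z i - z j) * (inner ℝ u (A v) + inner ℝ v (A u)), fun θ => ?_⟩
  rw [weightedDiag_exchange, weightedDiag_apply, weightedDiag_apply, add_assoc,
    ← sub_eq_iff_eq_add', ← Finset.sum_sub_distrib, Fintype.sum_eq_add i j h fun a ha => ?_]
  · simp only [rotatedDiag_apply, _root_.mul_inv_rev, rot_mul_apply,
      rot_planeRotation_inv_single_left h, rot_planeRotation_inv_single_right h, map_add, map_sub,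
      map_smul, inner_add_left, inner_add_right, inner_sub_left, inner_sub_right,
      real_inner_smul_left, real_inner_smul_right]
    linear_combination (z i * inner ℝ u (A u) + z j * inner ℝ v (A v)) * Real.sin_sq_add_cos_sq θ
  · simp only [rotatedDiag_apply, _root_.mul_inv_rev, rot_mul_apply,
      rot_planeRotation_inv_single_of_ne h ha.1 ha.2, sub_self]

theorem map_collisionPair_le {ν : Measure ℝ} [IsProbabilityMeasure ν]
    (hν : ∫ θ, Real.sin θ * Real.cos θ ∂ν = 0)
    {A : EuclideanSpace ℝ ι →L[ℝ] EuclideanSpace ℝ ι} {y : PairL1 ι r} {l : PairL1 ι r →L[ℝ] ℝ}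
    {z : ι → ℝ} (hl : ∀ g, l (actPair g y) ≤ weightedDiag A g z) (i j : ι)
    (g : orthogonalGroup ι ℝ) :
    l (collisionPair ν i j (actPair g y)) ≤
      weightedDiag A g (z + (∫ θ, Real.sin θ ^ 2 ∂ν) • exchange i j z) := by
  obtain ⟨c, hc⟩ := exists_weightedDiag_planeRotation_mul A g i j z
  have hsin := (integrable_sin_sq ν).const_mul (weightedDiag A g (exchange i j z))
  have hcos := (integrable_sin_mul_cos ν).const_mul c
  rw [collisionPair, map_average]
  refine (integral_mono (l.integrable_comp (integrable_actPair ν _ _))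
    (((integrable_const (weightedDiag A g z)).add hsin).add hcos) fun θ => ?_).trans_eq ?_
  · dsimp only
    rw [← actPair_mul]
    exact (hl _).trans_eq (hc θ)
  · rw [integral_add' ((integrable_const _).add hsin) hcos, integral_add' (integrable_const _) hsin,
      integral_const_mul, integral_const_mul, hν, integral_const, probReal_univ, one_smul, map_add,
      map_smul, smul_eq_mul]
    ring

end Collision

/-! ### The evolution of pairs -/

section Evolution

variable {ι : Type*} [Fintype ι] [DecidableEq ι] {r : ℝ} (κ : ι → ι → ℝ) (ν : Measure ℝ)
  [IsProbabilityMeasure ν]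

/-- The generator `∑ κ_{ij} (R_{ij} - I)`, on pairs, of random collisions with rates `κ`. -/
def collisionGenerator : PairL1 ι r →L[ℝ] PairL1 ι r :=
  ∑ i, ∑ j, κ i j • (collisionPair ν i j - 1)

theorem collisionGenerator_fst (y : PairL1 ι r) :
    (collisionGenerator κ ν y).1 = ∑ i, ∑ j, κ i j • (collision ν i j y.1 - y.1) := by
  simp only [collisionGenerator, _root_.sum_apply, _root_.smul_apply, _root_.sub_apply,
    one_apply_eq_self, Prod.fst_sum, Prod.smul_fst, Prod.fst_sub, collisionPair_fst]

theorem collisionGenerator_eq_sub : collisionGenerator (r := r) κ ν =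
    ∑ i, ∑ j, κ i j • collisionPair ν i j - (∑ i, ∑ j, κ i j) • 1 := by
  simp only [collisionGenerator, smul_sub, Finset.sum_sub_distrib, Finset.sum_smul]

/-- The generator of the heat flow on weights that corresponds to `collisionGenerator κ ν`. -/
def weightGenerator : (ι → ℝ) →L[ℝ] (ι → ℝ) :=
  (∫ θ, Real.sin θ ^ 2 ∂ν) • ∑ i, ∑ j, κ i j • exchange i j

variable {κ ν}

theorem map_sum_collisionPair_le (hκ : ∀ i j, 0 ≤ κ i j)
    (hν : ∫ θ, Real.sin θ * Real.cos θ ∂ν = 0)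
    {A : EuclideanSpace ℝ ι →L[ℝ] EuclideanSpace ℝ ι} {y : PairL1 ι r} {l : PairL1 ι r →L[ℝ] ℝ}
    {z : ι → ℝ} (hl : ∀ g, l (actPair g y) ≤ weightedDiag A g z) (g : orthogonalGroup ι ℝ) :
    l ((∑ i, ∑ j, κ i j • collisionPair ν i j) (actPair g y)) ≤
      weightedDiag A g ((weightGenerator κ ν + (∑ i, ∑ j, κ i j) • 1) z) := by
  have hweight : (weightGenerator κ ν + (∑ i, ∑ j, κ i j) • 1) z =
      ∑ i, ∑ j, κ i j • (z + (∫ θ, Real.sin θ ^ 2 ∂ν) • exchange i j z) := by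
    simp only [weightGenerator, _root_.add_apply, _root_.smul_apply, _root_.sum_apply,
      one_apply_eq_self, smul_add, Finset.sum_add_distrib, Finset.sum_smul, Finset.smul_sum,
      smul_comm (κ _ _), add_comm]
  simp only [hweight, _root_.sum_apply, _root_.smul_apply, map_sum,
    (weightedDiag A g).map_smul (κ _ _), l.map_smul, smul_eq_mul]
  exact Finset.sum_le_sum fun i _ => Finset.sum_le_sum fun j _ =>
    mul_le_mul_of_nonneg_left (map_collisionPair_le hν hl i j g) (hκ i j)

theorem map_sum_collisionPair_pow_le (hκ : ∀ i j, 0 ≤ κ i j)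
    (hν : ∫ θ, Real.sin θ * Real.cos θ ∂ν = 0)
    {A : EuclideanSpace ℝ ι →L[ℝ] EuclideanSpace ℝ ι} {y : PairL1 ι r} {l : PairL1 ι r →L[ℝ] ℝ}
    {z : ι → ℝ} (hl : ∀ g, l (actPair g y) ≤ weightedDiag A g z) (n : ℕ)
    (g : orthogonalGroup ι ℝ) :
    l (((∑ i, ∑ j, κ i j • collisionPair ν i j) ^ n) (actPair g y)) ≤
      weightedDiag A g (((weightGenerator κ ν + (∑ i, ∑ j, κ i j) • 1) ^ n) z) := by
  induction n generalizing g with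
  | zero => exact hl g
  | succ n ih =>
    rw [pow_succ, mul_apply_eq_comp, pow_succ', mul_apply_eq_comp]
    exact map_sum_collisionPair_le hκ hν
      (l := l.comp ((∑ i, ∑ j, κ i j • collisionPair ν i j) ^ n)) ih g

theorem map_exp_collisionGenerator_le (hκ : ∀ i j, 0 ≤ κ i j)
    (hν : ∫ θ, Real.sin θ * Real.cos θ ∂ν = 0)
    {A : EuclideanSpace ℝ ι →L[ℝ] EuclideanSpace ℝ ι} {y : PairL1 ι r} {l : PairL1 ι r →L[ℝ] ℝ}
    {z : ι → ℝ} (hl : ∀ g, l (actPair g y) ≤ weightedDiag A g z) {t : ℝ} (ht : 0 ≤ t) :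
    l (NormedSpace.exp (t • collisionGenerator κ ν) y) ≤
      weightedDiag A 1 (NormedSpace.exp (t • weightGenerator κ ν) z) := by
  have hpow (n : ℕ) := map_sum_collisionPair_pow_le hκ hν hl n 1
  simp only [actPair_one] at hpow
  rw [collisionGenerator_eq_sub, exp_smul_sub_smul_one,
    eq_sub_of_add_eq (rfl : weightGenerator κ ν + (∑ i, ∑ j, κ i j) • 1 = _),
    exp_smul_sub_smul_one, _root_.smul_apply, _root_.smul_apply, map_smul, map_smul]
  exact smul_le_smul_of_nonneg_left (apply_exp_smul_le hpow ht) (Real.exp_nonneg _)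

variable (κ ν) in
theorem exp_collisionGenerator_mem {y : PairL1 ι r} (hy : y ∈ weakGradientGraph ι r) (t : ℝ) :
    NormedSpace.exp (t • collisionGenerator κ ν) y ∈ weakGradientGraph ι r := by
  refine exp_apply_mem (isClosed_weakGradientGraph ι r) (fun y hy => ?_) hy
  simp only [collisionGenerator, _root_.smul_apply, _root_.sum_apply, _root_.sub_apply,
    one_apply_eq_self]
  refine Submodule.smul_mem _ _ <| Submodule.sum_mem _ fun i _ => Submodule.sum_mem _ fun j _ =>
    Submodule.smul_mem _ _ (Submodule.sub_mem _ ?_ hy)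
  exact average_mem ν _ (isClosed_weakGradientGraph ι r)
    (fun g _ => actPair_mem_weakGradientGraph g) hy

end Evolution

/-! ### The rates of the Kac evolution -/

section Rates

variable {M N : ℕ} {lamS lamR mu : ℝ} {ν : Measure ℝ}

/-- The rates of the collisions of the particles, each pair being counted once. -/
def rate (M N : ℕ) (lamS lamR mu : ℝ) : Particles M N → Particles M N → ℝ
  | .inl i, .inl j => if i < j then lamS / ((M : ℝ) - 1) else 0
  | .inl _, .inr _ => mu / N
  | .inr _, .inl _ => 0
  | .inr i, .inr j => if i < j then lamR / ((N : ℝ) - 1) else 0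

theorem rate_nonneg (hlamS : 0 ≤ lamS) (hlamR : 0 ≤ lamR) (hmu : 0 ≤ mu) (a b : Particles M N) :
    0 ≤ rate M N lamS lamR mu a b := by
  have hsub {n : ℕ} (i : Fin n) : (0 : ℝ) ≤ (n : ℝ) - 1 :=
    sub_nonneg.2 (Nat.one_le_cast.2 i.pos)
  rcases a with i | i <;> rcases b with j | j
  · exact ite_nonneg (div_nonneg hlamS (hsub i)) le_rfl
  · exact div_nonneg hmu N.cast_nonneg
  · exact le_rfl
  · exact ite_nonneg (div_nonneg hlamR (hsub i)) le_rfl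

theorem weightGenerator_rate_apply (b c : ℝ) :
    weightGenerator (rate M N lamS lamR mu) ν (Sum.elim (fun _ => b) fun _ => c) =
      ((∫ θ, Real.sin θ ^ 2 ∂ν) * (mu / N * (c - b))) •
        Sum.elim (fun _ => (N : ℝ)) fun _ => -(M : ℝ) := by
  have hsum : ∑ i : Fin M, ∑ j : Fin N,
      (Pi.single (.inl i) 1 - Pi.single (.inr j) 1 : Particles M N → ℝ) =
        Sum.elim (fun _ => (N : ℝ)) fun _ => -(M : ℝ) := by
    ext (a | a) <;> simp [Pi.single_apply]
  have happly (κ : Particles M N → Particles M N → ℝ) (z : Particles M N → ℝ) :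
      weightGenerator κ ν z = (∫ θ, Real.sin θ ^ 2 ∂ν) •
        ∑ a, ∑ b, κ a b • (z b - z a) • (Pi.single a 1 - Pi.single b 1) := by
    simp only [weightGenerator, _root_.smul_apply, _root_.sum_apply, exchange_apply]
  simp only [happly, Fintype.sum_sum_type, rate, Sum.elim_inl, Sum.elim_inr, sub_self, mul_zero,
    zero_mul, zero_smul, Finset.sum_const_zero, add_zero, zero_add, ← Finset.smul_sum, hsum,
    smul_smul]

theorem exp_weightGenerator_rate_apply (hMN : (M + N : ℝ) ≠ 0) {t e : ℝ}
    (he : Real.exp (-(mu * (∫ θ, Real.sin θ ^ 2 ∂ν) * ((M + N : ℝ) / N) * t)) = e) :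
    NormedSpace.exp (t • weightGenerator (rate M N lamS lamR mu) ν)
        (Sum.elim (fun _ => 1) fun _ => 0) =
      Sum.elim (fun _ => M / (M + N) + e * (N / (M + N)))
        fun _ => M / (M + N) - e * (M / (M + N)) := by
  have hinit : (Sum.elim (fun _ => 1) fun _ => 0 : Particles M N → ℝ) =
      (M / (M + N) : ℝ) • Sum.elim (fun _ => 1) (fun _ => 1) +
        (M + N : ℝ)⁻¹ • Sum.elim (fun _ => (N : ℝ)) fun _ => -(M : ℝ) := by
    ext (a | a)
    · simpa [div_eq_inv_mul, ← mul_add] using (inv_mul_cancel₀ hMN).symm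
    · simp [div_eq_inv_mul]
  have hmean := exp_apply_of_eq_smul (A := t • weightGenerator (rate M N lamS lamR mu) ν)
    (x := Sum.elim (fun _ => 1) fun _ => 1) (c := 0) (by
      rw [_root_.smul_apply, weightGenerator_rate_apply, sub_self, mul_zero, mul_zero, zero_smul,
        zero_smul, smul_zero])
  have hdiff := exp_apply_of_eq_smul (A := t • weightGenerator (rate M N lamS lamR mu) ν)
    (x := Sum.elim (fun _ => (N : ℝ)) fun _ => -(M : ℝ))
    (c := -(mu * (∫ θ, Real.sin θ ^ 2 ∂ν) * ((M + N : ℝ) / N) * t)) (by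
      rw [_root_.smul_apply, weightGenerator_rate_apply, smul_smul]
      congr 1
      ring)
  rw [hinit, map_add, map_smul, map_smul, hmean, hdiff, he, Real.exp_zero]
  ext (a | a)
  · simp only [Pi.add_apply, Pi.smul_apply, Sum.elim_inl, smul_eq_mul]
    ring
  · simp only [Pi.add_apply, Pi.smul_apply, Sum.elim_inr, smul_eq_mul]
    ring

theorem sum_ite_lt_smul {n : ℕ} {V : Type*} [AddCommGroup V] [Module ℝ V] (c : ℝ)
    (f : Fin n → Fin n → V) :
    ∑ i, ∑ j, (if i < j then c else 0) • f i j = c • ∑ i, ∑ j ∈ Finset.Ioi i, f i j := by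
  simp only [ite_smul, zero_smul, ← Finset.sum_filter, Finset.smul_sum, Finset.filter_lt_eq_Ioi]

variable [IsProbabilityMeasure ν]

theorem generator_eq_sum : generator M N lamS lamR mu ν =
    ∑ a, ∑ b, rate M N lamS lamR mu a b • (collision ν a b - 1) := by
  simp only [generator, Fintype.sum_sum_type, rate, zero_smul, Finset.sum_const_zero,
    Finset.sum_add_distrib, sum_ite_lt_smul, Finset.smul_sum]
  abel

theorem exp_collisionGenerator_rate_fst (t : ℝ)
    (y : PairL1 (Particles M N) (Real.sqrt (M + N))) :
    (NormedSpace.exp (t • collisionGenerator (rate M N lamS lamR mu) ν) y).1 =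
      evolution M N lamS lamR mu ν t y.1 := by
  refine map_exp_apply (B := t • generator M N lamS lamR mu ν) (.fst ℝ (State M N)
    (FieldL1 (Particles M N) (Real.sqrt (M + N)))) (fun y => ?_) y
  simp only [ContinuousLinearMap.coe_fst', _root_.smul_apply, Prod.smul_fst,
    collisionGenerator_fst, generator_eq_sum, _root_.sum_apply, _root_.sub_apply,
    one_apply_eq_self]

end Rates

/-! ### Rotations of the reservoir -/

section Reservoir

instance instIsProbabilityMeasureHaarSO (n : Type*) [Fintype n] [DecidableEq n] :
    IsProbabilityMeasure (haarSO n) :=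
  ⟨Measure.haarMeasure_self⟩

instance instIsMulLeftInvariantHaarSO (n : Type*) [Fintype n] [DecidableEq n] :
    (haarSO n).IsMulLeftInvariant :=
  inferInstanceAs (Measure.haarMeasure ⊤).IsMulLeftInvariant

instance instSecondCountableTopologySO (n : Type*) [Fintype n] [DecidableEq n] :
    SecondCountableTopology (specialOrthogonalGroup n ℝ) :=
  have : SecondCountableTopology (Matrix n n ℝ) :=
    inferInstanceAs (SecondCountableTopology (n → n → ℝ))
  TopologicalSpace.Subtype.secondCountableTopology _

variable {M N : ℕ}

theorem continuous_reservoirRotation :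
    Continuous (reservoirRotation : specialOrthogonalGroup (Fin N) ℝ →
      orthogonalGroup (Particles M N) ℝ) :=
  Continuous.subtype_mk (Continuous.matrix_fromBlocks continuous_const continuous_const
    continuous_const continuous_subtype_val) _

theorem reservoirRotation_mul (S T : specialOrthogonalGroup (Fin N) ℝ) :
    (reservoirRotation (S * T) : orthogonalGroup (Particles M N) ℝ) =
      reservoirRotation S * reservoirRotation T := by
  refine Subtype.ext ?_
  change fromBlocks 1 0 0 _ = fromBlocks 1 0 0 _ * fromBlocks 1 0 0 _
  rw [fromBlocks_multiply]
  simp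

theorem rot_reservoirRotation_inv_single (S : specialOrthogonalGroup (Fin N) ℝ) (i : Fin M) :
    rot (reservoirRotation S : orthogonalGroup (Particles M N) ℝ)⁻¹
      (EuclideanSpace.single (.inl i) 1) = EuclideanSpace.single (.inl i) 1 := by
  have hfix : rot (reservoirRotation S : orthogonalGroup (Particles M N) ℝ)
      (EuclideanSpace.single (.inl i) 1) = EuclideanSpace.single (.inl i) 1 := by
    ext k
    rw [rot_apply]
    rcases k with k | k <;> simp [reservoirRotation, Matrix.one_apply]
  conv_lhs => rw [← hfix]
  rw [rot_inv_rot]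

theorem rotatedDiag_reservoirRotation_mul
    (A : EuclideanSpace ℝ (Particles M N) →L[ℝ] EuclideanSpace ℝ (Particles M N))
    (S : specialOrthogonalGroup (Fin N) ℝ) (g : orthogonalGroup (Particles M N) ℝ) (i : Fin M) :
    rotatedDiag (reservoirRotation S * g) (.inl i) A = rotatedDiag g (.inl i) A := by
  rw [rotatedDiag_apply, rotatedDiag_apply, _root_.mul_inv_rev, rot_mul_apply,
    rot_reservoirRotation_inv_single]

theorem planeMatrix_eq_sq {ι : Type*} [Fintype ι] [DecidableEq ι] {i j : ι} (h : i ≠ j) (θ : ℝ) :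
    planeMatrix i j θ = planeMatrix i j (θ / 2) * planeMatrix i j (θ / 2) := by
  have hsin : Real.sin θ = 2 * Real.sin (θ / 2) * Real.cos (θ / 2) := by
    rw [← Real.sin_two_mul, mul_div_cancel₀ _ two_ne_zero]
  have hcos : Real.cos θ = Real.cos (θ / 2) ^ 2 - Real.sin (θ / 2) ^ 2 := by
    rw [← Real.cos_two_mul', mul_div_cancel₀ _ two_ne_zero]
  have h' := h.symm
  ext a b
  change _ = planeMatrix i j (θ / 2) a ⬝ᵥ fun k => planeMatrix i j (θ / 2) k b
  by_cases hai : a = i <;> by_cases haj : a = j <;> by_cases hbi : b = i <;>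
    by_cases hbj : b = j <;>
    simp_all [planeMatrix, Pi.single_apply, add_dotProduct] <;> ring

theorem det_planeMatrix {ι : Type*} [Fintype ι] [DecidableEq ι] {i j : ι} (h : i ≠ j) (θ : ℝ) :
    (planeMatrix i j θ).det = 1 := by
  have hdet := congrArg det ((mem_orthogonalGroup_iff _ _).1 (planeMatrix_mem h (θ / 2)))
  rw [det_mul, det_transpose, det_one] at hdet
  rw [planeMatrix_eq_sq h, det_mul, hdet]

theorem exists_reservoirRotation_eq {i j : Fin N} (h : i ≠ j) (θ : ℝ) :
    ∃ S : specialOrthogonalGroup (Fin N) ℝ,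
      (reservoirRotation S : orthogonalGroup (Particles M N) ℝ) =
        planeRotation (.inr i) (.inr j) θ := by
  refine ⟨⟨planeMatrix i j θ, mem_specialOrthogonalGroup_iff.2
    ⟨planeMatrix_mem h θ, det_planeMatrix h θ⟩⟩, Subtype.ext ?_⟩
  rw [planeRotation, dif_pos (Sum.inr_injective.ne h)]
  change fromBlocks 1 0 0 (planeMatrix i j θ) = planeMatrix (.inr i) (.inr j) θ
  ext a c
  rcases a with a | a <;> rcases c with c | c
  · simp [planeMatrix, Matrix.one_apply, Pi.single_apply, eq_comm]
  · simp [planeMatrix]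
  · by_cases hi : a = i <;> by_cases hj : a = j <;> simp_all [planeMatrix]
  · by_cases hi : a = i <;> by_cases hj : a = j <;> simp_all [planeMatrix, Pi.single_apply]

variable {r : ℝ}

/-- The marginal `𝒩`, on pairs. -/
def marginalPair : PairL1 (Particles M N) r →L[ℝ] PairL1 (Particles M N) r :=
  average (haarSO (Fin N)) ⟨reservoirRotation, continuous_reservoirRotation⟩

theorem marginalPair_fst (y : PairL1 (Particles M N) (Real.sqrt (M + N))) :
    (marginalPair y).1 = marginal y.1 :=
  average_fst (haarSO (Fin N)) _ y

theorem marginalPair_mem {y : PairL1 (Particles M N) r}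
    (hy : y ∈ weakGradientGraph (Particles M N) r) :
    marginalPair y ∈ weakGradientGraph (Particles M N) r :=
  average_mem _ _ (isClosed_weakGradientGraph _ r) (fun g _ => actPair_mem_weakGradientGraph g) hy

theorem actPair_marginalPair (T : specialOrthogonalGroup (Fin N) ℝ)
    (y : PairL1 (Particles M N) r) :
    actPair (reservoirRotation T) (marginalPair y) = marginalPair y := by
  rw [marginalPair, map_average, average_apply]
  simp only [ContinuousMap.coe_mk, ← actPair_mul, ← reservoirRotation_mul]
  exact integral_mul_left_eq_self (μ := haarSO (Fin N))
    (fun S => actPair (reservoirRotation S) y) T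

theorem map_marginalPair_le {A : EuclideanSpace ℝ (Particles M N) →L[ℝ]
      EuclideanSpace ℝ (Particles M N)} {y : PairL1 (Particles M N) r}
    {l : PairL1 (Particles M N) r →L[ℝ] ℝ}
    (hl : ∀ g, l (actPair g y) ≤ ∑ i : Fin M, rotatedDiag g (.inl i) A)
    (g : orthogonalGroup (Particles M N) ℝ) :
    l (marginalPair (actPair g y)) ≤ ∑ i : Fin M, rotatedDiag g (.inl i) A := by
  rw [marginalPair, map_average]
  refine (integral_mono (l.integrable_comp (integrable_actPair _ _ _)) (integrable_const _)
    fun S => ?_).trans_eq (by rw [integral_const, probReal_univ, one_smul])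
  rw [ContinuousMap.coe_mk, ← actPair_mul]
  exact (hl _).trans_eq (Finset.sum_congr rfl fun i _ =>
    rotatedDiag_reservoirRotation_mul A S g i)

end Reservoir

/-! ### Weak gradients of invariant functions -/

section Invariant

variable {ι : Type*} [Fintype ι] [DecidableEq ι] {r : ℝ} {i j : ι}

theorem rot_planeRotation_inv_eq (h : i ≠ j) (θ : ℝ) (x : EuclideanSpace ℝ ι) :
    rot (planeRotation i j θ)⁻¹ x =
      x + (x i * Real.cos θ - x j * Real.sin θ - x i) • EuclideanSpace.single i 1 +
        (x i * Real.sin θ + x j * Real.cos θ - x j) • EuclideanSpace.single j 1 := by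
  ext k
  rw [rot_planeRotation_inv h]
  by_cases hi : k = i <;> by_cases hj : k = j <;> simp_all [h.symm]

theorem rot_planeRotation_zero_inv (h : i ≠ j) (x : EuclideanSpace ℝ ι) :
    rot (planeRotation i j 0)⁻¹ x = x := by
  simp [rot_planeRotation_inv_eq h]

theorem hasDerivAt_rot_planeRotation_inv (h : i ≠ j) (θ : ℝ) (x : EuclideanSpace ℝ ι) :
    HasDerivAt (fun θ => rot (planeRotation i j θ)⁻¹ x)
      (rotField i j (rot (planeRotation i j θ)⁻¹ x)) θ := by
  have hfield : rotField i j (rot (planeRotation i j θ)⁻¹ x) =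
      (x i * -Real.sin θ - x j * Real.cos θ) • EuclideanSpace.single i 1 +
        (x i * Real.cos θ + x j * -Real.sin θ) • EuclideanSpace.single j 1 := by
    rw [rotField, rot_planeRotation_inv h, rot_planeRotation_inv h, if_pos rfl, if_neg h.symm,
      if_pos rfl]
    module
  have hi := (((Real.hasDerivAt_cos θ).const_mul (x i)).sub
    ((Real.hasDerivAt_sin θ).const_mul (x j))).sub_const (x i)
  have hj := (((Real.hasDerivAt_sin θ).const_mul (x i)).add
    ((Real.hasDerivAt_cos θ).const_mul (x j))).sub_const (x j)
  rw [hfield]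
  simp only [rot_planeRotation_inv_eq h]
  exact ((hi.smul_const (EuclideanSpace.single i (1 : ℝ))).const_add x).add
    (hj.smul_const (EuclideanSpace.single j (1 : ℝ)))

theorem hasDerivAt_integral_mul_comp_rot (h : i ≠ j) (F : SphereL1 ι r)
    {φ : EuclideanSpace ℝ ι → ℝ} (hφ : ContDiff ℝ ∞ φ) :
    HasDerivAt (fun θ => ∫ x, F x * φ (rot (planeRotation i j θ)⁻¹ x) ∂(sphereMeasure ι r))
      (∫ x, F x * fderiv ℝ φ x (rotField i j x) ∂(sphereMeasure ι r)) 0 := by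
  have hF : Integrable F (sphereMeasure ι r) := L1.integrable_coeFn F
  have hφ' : Continuous fun x => fderiv ℝ φ x (rotField i j x) :=
    (hφ.continuous_fderiv (by simp)).clm_apply (continuous_rotField i j)
  obtain ⟨C, hC⟩ := (isCompact_closedBall (0 : EuclideanSpace ℝ ι) |r|).exists_bound_of_continuousOn
    hφ'.continuousOn
  have hderiv := (hasDerivAt_integral_of_dominated_loc_of_deriv_le (μ := sphereMeasure ι r)
    (F := fun θ x => F x * φ (rot (planeRotation i j θ)⁻¹ x))
    (F' := fun θ x => F x * fderiv ℝ φ (rot (planeRotation i j θ)⁻¹ x)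
      (rotField i j (rot (planeRotation i j θ)⁻¹ x)))
    (bound := fun x => ‖F x‖ * C) (x₀ := (0 : ℝ)) Filter.univ_mem
    (.of_forall fun θ => hF.aestronglyMeasurable.mul
      (hφ.continuous.comp (rot _).continuous).aestronglyMeasurable)
    (hF.mul_of_top_left (memLp_top_of_continuous (hφ.continuous.comp (rot _).continuous)))
    (hF.aestronglyMeasurable.mul (hφ'.comp (rot _).continuous).aestronglyMeasurable) ?_
    (hF.norm.mul_const C) (.of_forall fun x θ _ =>
      ((hφ.differentiable (by simp) _).hasFDerivAt.comp_hasDerivAt θ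
        (hasDerivAt_rot_planeRotation_inv h θ x)).const_mul (F x))).2
  · simpa only [rot_planeRotation_zero_inv h] using hderiv
  · filter_upwards [ae_norm_eq r] with x hx θ _
    rw [norm_mul]
    refine mul_le_mul_of_nonneg_left (hC _ ?_) (norm_nonneg _)
    rw [mem_closedBall_zero_iff, LinearIsometryEquiv.norm_map, hx]

theorem integral_fderiv_rotField_eq_zero (h : i ≠ j) {F : SphereL1 ι r}
    (hinv : ∀ θ, act (planeRotation i j θ) F = F) {φ : EuclideanSpace ℝ ι → ℝ}
    (hφ : ContDiff ℝ ∞ φ) :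
    ∫ x, F x * fderiv ℝ φ x (rotField i j x) ∂(sphereMeasure ι r) = 0 := by
  have hconst (θ : ℝ) : ∫ x, F x * φ (rot (planeRotation i j θ)⁻¹ x) ∂(sphereMeasure ι r) =
      ∫ x, F x * φ x ∂(sphereMeasure ι r) := by
    rw [← integral_comp_rot r (planeRotation i j θ)⁻¹ fun x => F x * φ x]
    refine integral_congr_ae ?_
    filter_upwards [act_coeFn (planeRotation i j θ) F] with x hx
    rw [← hx, hinv]
  have hderiv := hasDerivAt_integral_mul_comp_rot h F hφ
  simp only [hconst] at hderiv
  exact hderiv.unique (hasDerivAt_const (0 : ℝ) _)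

theorem inner_rotField_ae_eq_zero (h : i ≠ j) {F : SphereL1 ι r}
    (hinv : ∀ θ, act (planeRotation i j θ) F = F)
    {G : EuclideanSpace ℝ ι → EuclideanSpace ℝ ι} (hG : IsWeakGradient r F G) :
    ∀ᵐ x ∂(sphereMeasure ι r), inner ℝ (rotField i j x) (G x) = 0 := by
  refine ae_eq_zero_of_integral_contDiff_smul_eq_zero
    (integrable_inner_of_memLp_top (memLp_top_of_continuous (continuous_rotField i j))
      hG.integrable).locallyIntegrable fun φ hφ _ => ?_
  have hparts := hG.integral_eq i j φ hφ
  rw [integral_fderiv_rotField_eq_zero h hinv hφ] at hparts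
  simpa using hparts.symm

theorem IsWeakGradient.parallel_of_invariant {M N : ℕ} {F : SphereL1 (Particles M N) r}
    (hinv : ∀ S, act (reservoirRotation S) F = F)
    {G : EuclideanSpace ℝ (Particles M N) → EuclideanSpace ℝ (Particles M N)}
    (hG : IsWeakGradient r F G) :
    ∀ᵐ x ∂(sphereMeasure (Particles M N) r), ∀ i j : Fin N,
      x (.inr i) * G x (.inr j) = x (.inr j) * G x (.inr i) := by
  refine ae_all_iff.2 fun i => ae_all_iff.2 fun j => ?_
  rcases eq_or_ne i j with rfl | hij
  · exact .of_forall fun x => rfl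
  · have hplane (θ : ℝ) : act (planeRotation (.inr i) (.inr j) θ) F = F := by
      obtain ⟨S, hS⟩ := exists_reservoirRotation_eq (M := M) hij θ
      rw [← hS, hinv]
    filter_upwards [inner_rotField_ae_eq_zero (Sum.inr_injective.ne hij) hplane hG] with x hx
    rw [rotField, inner_sub_left, real_inner_smul_left, real_inner_smul_left,
      EuclideanSpace.inner_single_left, EuclideanSpace.inner_single_left] at hx
    simpa [sub_eq_zero] using hx

end Invariant

/-! ### Duality for the Fisher information -/

section Truncation

/-- Bounded approximations of `1 / f` on the set where the gradient has length `s ≤ n`; multiplied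
by the gradient, they give the bounded fields that nearly maximize the dual functional. -/
def truncatedInv (n : ℕ) (f s : ℝ) : ℝ :=
  if s ≤ n then (max f 0 + 1 / ((n : ℝ) + 1))⁻¹ else 0

theorem max_zero_add_pos (n : ℕ) (f : ℝ) : 0 < max f 0 + 1 / ((n : ℝ) + 1) :=
  add_pos_of_nonneg_of_pos (le_max_right f 0) Nat.one_div_pos_of_nat

theorem truncatedInv_nonneg (n : ℕ) (f s : ℝ) : 0 ≤ truncatedInv n f s :=
  ite_nonneg (inv_nonneg.2 (max_zero_add_pos n f).le) le_rfl

theorem truncatedInv_mul_self_le_one (n : ℕ) (f s : ℝ) : truncatedInv n f s * f ≤ 1 := by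
  unfold truncatedInv
  split_ifs
  · refine inv_mul_le_one_of_le₀ ((le_max_left f 0).trans ?_) (max_zero_add_pos n f).le
    exact le_add_of_nonneg_right Nat.one_div_pos_of_nat.le
  · exact (zero_mul f).trans_le zero_le_one

theorem truncatedInv_mul_le (n : ℕ) (f s : ℝ) : truncatedInv n f s * s ≤ (n + 1) * n := by
  unfold truncatedInv
  split_ifs with hs
  · have hinv : (max f 0 + 1 / ((n : ℝ) + 1))⁻¹ ≤ n + 1 := by
      refine inv_le_of_inv_le₀ (by positivity) ?_
      exact (one_div _).symm.trans_le (le_add_of_nonneg_left (le_max_right f 0))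
    exact (mul_le_mul_of_nonneg_left hs (inv_nonneg.2 (max_zero_add_pos n f).le)).trans
      (mul_le_mul_of_nonneg_right hinv n.cast_nonneg)
  · rw [zero_mul]
    positivity

theorem measurable_truncatedInv (n : ℕ) : Measurable (Function.uncurry (truncatedInv n)) :=
  Measurable.ite (measurableSet_le measurable_snd measurable_const) (by fun_prop) measurable_const

open Filter Topology in
theorem tendsto_ofReal_truncatedInv_mul {E : Type*} [NormedAddCommGroup E] (f : ℝ) (v : E) :
    Tendsto (fun n => ENNReal.ofReal (truncatedInv n f ‖v‖ * ‖v‖ ^ 2)) atTop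
      (𝓝 (‖v‖ₑ ^ 2 / ENNReal.ofReal f)) := by
  have hdenom : Tendsto (fun n : ℕ => ENNReal.ofReal (max f 0 + 1 / ((n : ℝ) + 1))) atTop
      (𝓝 (ENNReal.ofReal f)) := by
    have hlim := (tendsto_one_div_add_atTop_nhds_zero_nat (𝕜 := ℝ)).const_add (max f 0)
    rw [add_zero] at hlim
    simpa using ENNReal.tendsto_ofReal hlim
  refine (ENNReal.Tendsto.const_div hdenom (.inr (by finiteness))).congr' ?_
  filter_upwards [eventually_ge_atTop ⌈‖v‖⌉₊] with n hn
  rw [truncatedInv, if_pos (Nat.ceil_le.1 hn), mul_comm, ← div_eq_mul_inv,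
    ENNReal.ofReal_div_of_pos (max_zero_add_pos n f), ENNReal.ofReal_pow (norm_nonneg v),
    ofReal_norm]

theorem truncatedInv_mul_norm_sq_le {E : Type*} [NormedAddCommGroup E] [InnerProductSpace ℝ E]
    (n : ℕ) (f : ℝ) (v : E) :
    truncatedInv n f ‖v‖ * ‖v‖ ^ 2 ≤
      2 * inner ℝ (truncatedInv n f ‖v‖ • v) v - ‖truncatedInv n f ‖v‖ • v‖ ^ 2 * f := by
  have hle : truncatedInv n f ‖v‖ * ‖v‖ ^ 2 * (truncatedInv n f ‖v‖ * f) ≤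
      truncatedInv n f ‖v‖ * ‖v‖ ^ 2 :=
    mul_le_of_le_one_right (mul_nonneg (truncatedInv_nonneg n f ‖v‖) (sq_nonneg _))
      (truncatedInv_mul_self_le_one n f ‖v‖)
  rw [real_inner_smul_left, real_inner_self_eq_norm_sq, norm_smul, mul_pow, Real.norm_eq_abs,
    sq_abs]
  linarith

end Truncation

section Duality

variable {ι : Type*} [Fintype ι] {r : ℝ}

theorem memLp_top_truncatedInv_smul (z : PairL1 ι r) (n : ℕ) :
    MemLp (fun x => truncatedInv n (z.1 x) ‖z.2 x‖ • z.2 x) ∞ (sphereMeasure ι r) := by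
  have hF : Measurable z.1 := (Lp.stronglyMeasurable z.1).measurable
  have hG : Measurable z.2 := (Lp.stronglyMeasurable z.2).measurable
  refine memLp_top_of_bound (((measurable_truncatedInv n).comp
    (hF.prodMk hG.norm)).smul hG).aestronglyMeasurable ((n + 1) * n) (.of_forall fun x => ?_)
  rw [norm_smul, Real.norm_of_nonneg (truncatedInv_nonneg n _ _)]
  exact truncatedInv_mul_le n _ _

open Filter in
theorem fisherIntegral_le_of_forall_fisherFunctional_le {z : PairL1 ι r} {C : ℝ}
    (hC : ∀ (c : EuclideanSpace ℝ ι → ℝ) (hc : MemLp (fun x => c x • z.2 x) ∞ (sphereMeasure ι r)),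
      fisherFunctional hc z ≤ C) :
    fisherIntegral z ≤ ENNReal.ofReal C := by
  have hF : Measurable z.1 := (Lp.stronglyMeasurable z.1).measurable
  have hG : Measurable z.2 := (Lp.stronglyMeasurable z.2).measurable
  let u (n : ℕ) (x : EuclideanSpace ℝ ι) : ℝ := truncatedInv n (z.1 x) ‖z.2 x‖ * ‖z.2 x‖ ^ 2
  have hu (n : ℕ) : Measurable (u n) :=
    ((measurable_truncatedInv n).comp (hF.prodMk hG.norm)).mul (hG.norm.pow_const 2)
  have hle (n : ℕ) : ∫⁻ x, ENNReal.ofReal (u n x) ∂(sphereMeasure ι r) ≤ ENNReal.ofReal C := by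
    have hq := memLp_top_truncatedInv_smul z n
    have hint := integrable_fisherFunctional hq z
    have hmono : ∫ x, u n x ∂(sphereMeasure ι r) ≤ fisherFunctional hq z := by
      rw [fisherFunctional_apply]
      exact integral_mono_of_nonneg
        (.of_forall fun x => mul_nonneg (truncatedInv_nonneg n _ _) (sq_nonneg _)) hint
        (.of_forall fun x => truncatedInv_mul_norm_sq_le n _ _)
    rw [← ofReal_integral_eq_lintegral_ofReal]
    · exact ENNReal.ofReal_le_ofReal (hmono.trans (hC _ hq))
    · simpa only [u, real_inner_smul_left, real_inner_self_eq_norm_sq] using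
        integrable_inner_of_memLp_top hq (L1.integrable_coeFn z.2)
    · exact .of_forall fun x => mul_nonneg (truncatedInv_nonneg n _ _) (sq_nonneg _)
  calc fisherIntegral z
      = ∫⁻ x, liminf (fun n => ENNReal.ofReal (u n x)) atTop ∂(sphereMeasure ι r) :=
        lintegral_congr fun x => (tendsto_ofReal_truncatedInv_mul _ _).liminf_eq.symm
    _ ≤ liminf (fun n => ∫⁻ x, ENNReal.ofReal (u n x) ∂(sphereMeasure ι r)) atTop :=
        lintegral_liminf_le fun n => (hu n).ennreal_ofReal
    _ ≤ ENNReal.ofReal C := liminf_le_of_frequently_le' (.of_forall hle)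

end Duality

section Information

variable {ι : Type*} [Fintype ι] [DecidableEq ι] {r : ℝ}

theorem IsWeakGradient.congr {F : EuclideanSpace ℝ ι → ℝ}
    {G G' : EuclideanSpace ℝ ι → EuclideanSpace ℝ ι}
    (h : IsWeakGradient r F G) (hG : G =ᵐ[sphereMeasure ι r] G') : IsWeakGradient r F G' where
  integrable := h.integrable.congr hG
  tangent := by
    filter_upwards [h.tangent, hG] with x htangent hx
    rwa [← hx]
  integral_eq i j φ hφ := by
    rw [h.integral_eq i j φ hφ]
    refine congrArg _ (integral_congr_ae ?_)
    filter_upwards [hG] with x hx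
    rw [hx]

theorem fisherInformation_eq_iInf (F : SphereL1 ι r) :
    fisherInformation r F =
      ⨅ (G : FieldL1 ι r) (_ : (F, G) ∈ weakGradientGraph ι r), fisherIntegral (F, G) := by
  refine le_antisymm (le_iInf₂ fun G hG => iInf₂_le (G : EuclideanSpace ℝ ι → EuclideanSpace ℝ ι)
    (mem_weakGradientGraph.1 hG)) (le_iInf₂ fun G hG => ?_)
  have hcoe := hG.integrable.coeFn_toL1
  refine (iInf₂_le (hG.integrable.toL1 G)
    (mem_weakGradientGraph.2 (hG.congr hcoe.symm))).trans_eq (lintegral_congr_ae ?_)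
  filter_upwards [hcoe] with x hx
  rw [hx]

end Information

/-! ### The bound on the information of the marginal -/

section Marginal

theorem weightedDiag_le {ι : Type*} [Fintype ι] [DecidableEq ι]
    {A : EuclideanSpace ℝ ι →L[ℝ] EuclideanSpace ℝ ι} {g : orthogonalGroup ι ℝ}
    (hA : ∀ a, 0 ≤ rotatedDiag g a A) {z : ι → ℝ} {b : ℝ} (hz : ∀ a, z a ≤ b) :
    weightedDiag A g z ≤ b * ∑ a, rotatedDiag g a A := by
  rw [weightedDiag_apply, mul_comm, Finset.sum_mul]
  exact Finset.sum_le_sum fun a _ => mul_le_mul_of_nonneg_left (hz a) (hA a)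

variable {M N : ℕ} {r : ℝ}

theorem marginalPair_snd_parallel {y : PairL1 (Particles M N) r}
    (hy : y ∈ weakGradientGraph (Particles M N) r) :
    ∀ᵐ x ∂(sphereMeasure (Particles M N) r), ∀ i j : Fin N,
      x (.inr i) * (marginalPair y).2 x (.inr j) = x (.inr j) * (marginalPair y).2 x (.inr i) :=
  (mem_weakGradientGraph.1 (marginalPair_mem hy)).parallel_of_invariant fun S => by
    rw [← actPair_fst, actPair_marginalPair]

variable {lamS lamR mu : ℝ} {ν : Measure ℝ} [IsProbabilityMeasure ν] {t e : ℝ}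
  {y : PairL1 (Particles M N) r}

theorem fisherFunctional_marginalPair_exp_le (hMN : (M + N : ℝ) ≠ 0) (hlamS : 0 ≤ lamS)
    (hlamR : 0 ≤ lamR) (hmu : 0 ≤ mu) (hν : ∫ θ, Real.sin θ * Real.cos θ ∂ν = 0) (hr : r ≠ 0)
    (ht : 0 ≤ t)
    (he : Real.exp (-(mu * (∫ θ, Real.sin θ ^ 2 ∂ν) * ((M + N : ℝ) / N) * t)) = e)
    (hfin : HasFiniteFisher y)
    (htangent : ∀ᵐ x ∂(sphereMeasure (Particles M N) r), inner ℝ x (y.2 x) = 0)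
    {h : EuclideanSpace ℝ (Particles M N) → EuclideanSpace ℝ (Particles M N)}
    (hh : MemLp h ∞ (sphereMeasure (Particles M N) r))
    (hpar : ∀ᵐ x ∂(sphereMeasure (Particles M N) r), ∀ i j : Fin N,
      x (.inr i) * h x (.inr j) = x (.inr j) * h x (.inr i)) :
    fisherFunctional hh (marginalPair
        (NormedSpace.exp (t • collisionGenerator (rate M N lamS lamR mu) ν) y)) ≤
      2 * (M / (M + N) + e * (N / (M + N))) *
        ∫ x, ‖y.2 x‖ ^ 2 / y.1 x ∂(sphereMeasure (Particles M N) r) := by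
  have hrow (g : orthogonalGroup (Particles M N) ℝ) :
      (fisherFunctional hh).comp marginalPair (actPair g y) ≤
        weightedDiag (fisherOperator y) g (Sum.elim (fun _ => 1) fun _ => 0) := by
    refine (map_marginalPair_le
      (hfin.fisherFunctional_actPair_le hr htangent hh hpar) g).trans_eq ?_
    simp [weightedDiag_apply]
  have hflow := map_exp_collisionGenerator_le (rate_nonneg hlamS hlamR hmu) hν hrow ht
  rw [exp_weightGenerator_rate_apply hMN he] at hflow
  have he0 : 0 ≤ e := he ▸ Real.exp_nonneg _
  have hweight : ∀ a : Particles M N, Sum.elim (fun _ => (M / (M + N) + e * (N / (M + N)) : ℝ))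
      (fun _ => M / (M + N) - e * (M / (M + N))) a ≤ M / (M + N) + e * (N / (M + N))
    | .inl _ => le_rfl
    | .inr _ => (sub_le_self _ (by positivity)).trans (le_add_of_nonneg_right (by positivity))
  refine (hflow.trans (weightedDiag_le (hfin.rotatedDiag_fisherOperator_nonneg 1)
    hweight)).trans_eq ?_
  rw [hfin.sum_rotatedDiag_fisherOperator hr]
  ring

theorem fisherIntegral_marginalPair_exp_le (hMN : (M + N : ℝ) ≠ 0) (hlamS : 0 ≤ lamS)
    (hlamR : 0 ≤ lamR) (hmu : 0 ≤ mu) (hν : ∫ θ, Real.sin θ * Real.cos θ ∂ν = 0) (hr : r ≠ 0)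
    (ht : 0 ≤ t)
    (he : Real.exp (-(mu * (∫ θ, Real.sin θ ^ 2 ∂ν) * ((M + N : ℝ) / N) * t)) = e)
    (hfin : HasFiniteFisher y) (hy : y ∈ weakGradientGraph (Particles M N) r) :
    fisherIntegral (marginalPair
        (NormedSpace.exp (t • collisionGenerator (rate M N lamS lamR mu) ν) y)) ≤
      ENNReal.ofReal (2 * (M / (M + N) + e * (N / (M + N)))) * fisherIntegral y := by
  have he0 : 0 ≤ e := he ▸ Real.exp_nonneg _
  rw [hfin.fisherIntegral_eq, ← ENNReal.ofReal_mul (by positivity)]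
  refine fisherIntegral_le_of_forall_fisherFunctional_le fun c hc =>
    fisherFunctional_marginalPair_exp_le hMN hlamS hlamR hmu hν hr ht he hfin
      (mem_weakGradientGraph.1 hy).tangent hc ?_
  filter_upwards [marginalPair_snd_parallel (exp_collisionGenerator_mem _ ν hy t)] with x hx i j
  simp only [PiLp.smul_apply, smul_eq_mul]
  linear_combination c x * hx i j

theorem marginalPair_exp_fst (y : PairL1 (Particles M N) (Real.sqrt (M + N))) :
    (marginalPair (NormedSpace.exp (t • collisionGenerator (rate M N lamS lamR mu) ν) y)).1 =
      marginal (evolution M N lamS lamR mu ν t y.1) := by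
  rw [marginalPair_fst, exp_collisionGenerator_rate_fst]

end Marginal

end

end Kac

open Kac in
theorem theorem3_general (M N : ℕ) (hN : 1 ≤ N)
    (lamS lamR mu : ℝ) (hlamS : 0 ≤ lamS) (hlamR : 0 ≤ lamR) (hmu : 0 ≤ mu)
    (ν : MeasureTheory.Measure ℝ) [MeasureTheory.IsProbabilityMeasure ν]
    (hν : ∫ θ, Real.sin θ * Real.cos θ ∂ν = 0)
    (F₀ : Kac.State M N) (hF₀ : 0 ≤ F₀) (t : ℝ) (ht : 0 ≤ t) :
    Kac.information (Kac.marginal (Kac.evolution M N lamS lamR mu ν t F₀)) ≤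
      ENNReal.ofReal
        (2 * ((M : ℝ) / (M + N) +
            Real.exp (-(mu * (∫ θ, Real.sin θ ^ 2 ∂ν) * ((M + N : ℝ) / N) * t)) *
              ((N : ℝ) / (M + N)))) *
        Kac.information F₀ := by
  have hN0 : (0 : ℝ) < N := Nat.cast_pos.2 hN
  have hMN : (0 : ℝ) < M + N := add_pos_of_nonneg_of_pos M.cast_nonneg hN0
  have hc : ENNReal.ofReal (2 * ((M : ℝ) / (M + N) +
      Real.exp (-(mu * (∫ θ, Real.sin θ ^ 2 ∂ν) * ((M + N : ℝ) / N) * t)) *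
        ((N : ℝ) / (M + N)))) ≠ 0 :=
    (ENNReal.ofReal_pos.2 (by positivity)).ne'
  simp only [information, fisherInformation_eq_iInf,
    ENNReal.mul_iInf_of_ne hc ENNReal.ofReal_ne_top]
  refine le_iInf₂ fun G hG => ?_
  by_cases hfin : fisherIntegral (F₀, G) = ⊤
  · exact le_top.trans_eq (by rw [hfin, ENNReal.mul_top hc])
  have hpair : (marginal (evolution M N lamS lamR mu ν t F₀), _) = _ :=
    Prod.ext (marginalPair_exp_fst (F₀, G)).symm rfl
  refine (iInf₂_le _ ?_).trans ((congrArg fisherIntegral hpair).trans_le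
    (fisherIntegral_marginalPair_exp_le hMN.ne' hlamS hlamR hmu hν (Real.sqrt_pos.2 hMN).ne' ht rfl
      (hasFiniteFisher_of_fisherIntegral_ne_top ((Lp.coeFn_nonneg F₀).2 hF₀) hfin) hG))
  rw [hpair]
  exact marginalPair_mem (exp_collisionGenerator_mem _ ν hG t)

theorem theorem3 (M N : ℕ) (hM : 1 ≤ M) (hN : 1 ≤ N)
    (lamS lamR mu : ℝ) (hlamS : 0 ≤ lamS) (hlamR : 0 ≤ lamR) (hmu : 0 ≤ mu)
    (ν : MeasureTheory.Measure ℝ) [MeasureTheory.IsProbabilityMeasure ν]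
    (hν : ∫ θ, Real.sin θ * Real.cos θ ∂ν = 0)
    (F₀ : Kac.State M N) (hF₀ : 0 ≤ F₀)
    (hinv : ∀ S : Matrix.specialOrthogonalGroup (Fin N) ℝ,
      Kac.act (Kac.reservoirRotation S) F₀ = F₀)
    (t : ℝ) (ht : 0 ≤ t) :
    Kac.information (Kac.marginal (Kac.evolution M N lamS lamR mu ν t F₀)) ≤
      ENNReal.ofReal
        (2 * ((M : ℝ) / (M + N) +
            Real.exp (-(mu * (∫ θ, Real.sin θ ^ 2 ∂ν) * ((M + N : ℝ) / N) * t)) *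
              ((N : ℝ) / (M + N))) +
          (M : ℝ) / N) *
        Kac.information F₀ := by
  exact (theorem3_general M N hN lamS lamR mu hlamS hlamR hmu ν hν F₀ hF₀ t ht).trans
    (by gcongr; exact le_add_of_nonneg_right (by positivity))
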